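/- All Banach spaces are real; $L(X,Y)$ is the space of bounded linear operators with the operator norm, $X^*=L(X,\mathbb R)$, and $B_X$ is the closed unit ball of $X$. Let $1\le p\le\infty$. A sequence $(x_n)$ in $X$ is weakly $p$-summable if $(x^*(x_n))_n\in\ell_p$ for every $x^*\in X^*$; for $p=\infty$ this means, as usual, that $(x_n)$ is weakly null. A bounded set $D\subset X$ is a Dunford–Pettis set if every weakly null sequence in $X^*$ converges to $0$ uniformly on $D$. A sequence in $X$ is $p$-Right null if it is weakly $p$-summable and its range is a Dunford–Pettis set. A set $K\subset L(X,Y)$ is a $p$-(DPL) set if $\lim_n\sup_{T\in K}\|T(x_n)\|=0$ for every $p$-Right null sequence $(x_n)$ in $X$. An operator $T\in L(X,Y)$ is Dunford–Pettis $p$-convergent, $T\in DPC_p(X,Y)$, if $\|T(x_n)\|\to0$ for every $p$-Right null sequence $(x_n)$ in $X$. **Proposition.** Let $X,Y$ be Banach spaces and $1\le p\le\infty$. - (i) If $K\subset DPC_p(X,Y)$ is relatively compact (in the operator norm), then $K$ is a $p$-(DPL) set in $L(X,Y)$. - (ii) The closed absolutely convex hull of a $p$-(DPL) set in $L(X,Y)$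 is a $p$-(DPL) set. - (iii) Every relatively weakly compact subset of $X^*$ is a $p$-(DPL) set in $X^*$. - (iv) For $T\in L(X,Y)$: $T\in DPC_p(X,Y)$ if and only if $T^*(B_{Y^*})$ is a $p$-(DPL) set in $X^*$. - (v) If $p<q\le\infty$, then every $q$-(DPL) subset of $X^*$ is a $p$-(DPL) subset of $X^*$. The converse fails: for all $1\le p<q\le\infty$ there are a Banach space $Z$ and a set $K\subset Z^*$ that is $p$-(DPL) but not $q$-(DPL). - (vi) If $K\subset L(X,Y)$ is a $p$-(DPL) set, then every $T\in K$ is Dunford–Pettis $p$-convergent. - (vii) If $\Omega$ is a compact Hausdorff space and $p<q\le\infty$, then every $p$-(DPL) set in $M(\Omega)=C(\Omega)^*$, the space of finite regular signed Borel measures on $\Omega$ (acting on $C(\Omega)$ by integration), is a $q$-(DPL) set. -/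

import Mathlib

open Filter Topology MeasureTheory
open scoped ENNReal

namespace DPLSets

section Banach

variable {X Y : Type*} [NormedAddCommGroup X] [NormedSpace ℝ X]
  [NormedAddCommGroup Y] [NormedSpace ℝ Y]

/-- A sequence is weakly null if every bounded linear functional maps it to a null sequence. -/
def IsWeaklyNull (x : ℕ → X) : Prop :=
  ∀ φ : StrongDual ℝ X, Tendsto (fun n => φ (x n)) atTop (𝓝 0)

/-- Weakly `p`-summable sequences, `1 ≤ p ≤ ∞`: the scalar sequences `(x^*(x_n))` lie in `ℓ_p` for
every `x^*` in the dual. As usual, for `p = ∞` the space `ℓ_∞` is replaced by `c_0`, that is,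
weakly `∞`-summable means weakly null. -/
def IsWeaklySummable (p : ℝ≥0∞) (x : ℕ → X) : Prop :=
  (p ≠ ∞ → ∀ φ : StrongDual ℝ X, Memℓp (fun n => φ (x n)) p) ∧ (p = ∞ → IsWeaklyNull x)

/-- A Dunford-Pettis set: a bounded set on which every weakly null sequence of the dual converges
uniformly to zero. -/
def IsDunfordPettisSet (K : Set X) : Prop :=
  Bornology.IsBounded K ∧
    ∀ φ : ℕ → StrongDual ℝ X, IsWeaklyNull φ →
      TendstoUniformlyOn (fun n x => φ n x) (fun _ => 0) atTop K

/-- A `p`-Right null sequence: a weakly `p`-summable sequence whose range is a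
Dunford-Pettis set. -/
def IsRightNull (p : ℝ≥0∞) (x : ℕ → X) : Prop :=
  IsWeaklySummable p x ∧ IsDunfordPettisSet (Set.range x)

/-- A `p`-(DPL) set of operators: `sup_{T ∈ K} ‖T x_n‖ → 0` for every `p`-Right null sequence
`(x_n)`. The supremum is taken in `[0, ∞]`. -/
def IsDPL (p : ℝ≥0∞) (K : Set (X →L[ℝ] Y)) : Prop :=
  ∀ x : ℕ → X, IsRightNull p x →
    Tendsto (fun n => ⨆ T ∈ K, ‖T (x n)‖ₑ) atTop (𝓝 0)

/-- The class `DPC_p(X, Y)` of Dunford-Pettis `p`-convergent operators: those which map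
Dunford-Pettis weakly `p`-summable sequences to norm null sequences. -/
def DPC (p : ℝ≥0∞) (X Y : Type*) [NormedAddCommGroup X] [NormedSpace ℝ X]
    [NormedAddCommGroup Y] [NormedSpace ℝ Y] : Set (X →L[ℝ] Y) :=
  {T | ∀ x : ℕ → X, IsRightNull p x → Tendsto (fun n => T (x n)) atTop (𝓝 0)}

/-- Relatively norm compact sets. -/
def IsRelCompact (K : Set X) : Prop :=
  IsCompact (closure K)

/-- Relatively weakly compact sets: the closure in the weak topology `σ(X, X^*)` is compact. -/
def IsRelWeaklyCompact (K : Set X) : Prop :=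
  IsCompact (closure (toWeakSpace ℝ X '' K))

/-- The adjoint `T^* : Y^* → X^*`, `T^* φ = φ ∘ T`. -/
noncomputable def adjoint (T : X →L[ℝ] Y) : StrongDual ℝ Y →L[ℝ] StrongDual ℝ X :=
  ContinuousLinearMap.precomp ℝ T

end Banach

section Measures

variable {Ω : Type*} [TopologicalSpace Ω] [CompactSpace Ω] [MeasurableSpace Ω] [BorelSpace Ω]

/-- `M(Ω)` as a set of measures: the (finite) signed Borel measures which are regular, that is,
whose total variation is a regular measure. -/
def regularSignedMeasures (Ω : Type*) [TopologicalSpace Ω] [MeasurableSpace Ω] :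
    Set (SignedMeasure Ω) :=
  {μ | μ.totalVariation.Regular}

theorem integrable_continuousMap (ν : Measure Ω) [IsFiniteMeasure ν] (f : C(Ω, ℝ)) :
    Integrable (fun x => f x) ν :=
  (BoundedContinuousFunction.mkOfCompact f).integrable ν

theorem abs_integral_le (ν : Measure Ω) [IsFiniteMeasure ν] (f : C(Ω, ℝ)) :
    ‖∫ x, f x ∂ν‖ ≤ ν.real Set.univ * ‖f‖ := by
  have h := norm_integral_le_of_norm_le_const (μ := ν) (f := fun x => f x) (C := ‖f‖)
    (Eventually.of_forall fun x => f.norm_coe_le_norm x)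
  linarith [mul_comm ‖f‖ (ν.real Set.univ)]

/-- The functional `f ↦ ∫ f dμ = ∫ f dμ⁺ - ∫ f dμ⁻` on `C(Ω)` given by a signed measure `μ`; it
realizes the identification `M(Ω) = C(Ω)^*`. -/
noncomputable def integralFunctional (μ : SignedMeasure Ω) : StrongDual ℝ C(Ω, ℝ) :=
  LinearMap.mkContinuous
    { toFun := fun f => ∫ x, f x ∂μ.toJordanDecomposition.posPart
        - ∫ x, f x ∂μ.toJordanDecomposition.negPart
      map_add' := fun f g => by
        simp only [ContinuousMap.add_apply]
        rw [integral_add (integrable_continuousMap _ f) (integrable_continuousMap _ g),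
          integral_add (integrable_continuousMap _ f) (integrable_continuousMap _ g)]
        ring
      map_smul' := fun c f => by
        simp only [ContinuousMap.smul_apply, smul_eq_mul, integral_const_mul, RingHom.id_apply]
        ring }
    (μ.toJordanDecomposition.posPart.real Set.univ
      + μ.toJordanDecomposition.negPart.real Set.univ)
    (fun f => by
      rw [add_mul]
      exact (norm_sub_le _ _).trans (add_le_add (abs_integral_le _ f) (abs_integral_le _ f)))

end Measures

end DPLSets

set_option linter.unusedSectionVars false

namespace DPLSets

/-! ### Elementary permanence properties and a sequential test for Dunford–Pettis ranges -/

section Basic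

variable {X Y : Type*} [NormedAddCommGroup X] [NormedSpace ℝ X]
  [NormedAddCommGroup Y] [NormedSpace ℝ Y]

/-! Parts (i), (ii), (iv), (vi) and the inclusion in (v) are direct: finite nets, a closed
absolutely convex preimage, norming functionals, and the monotonicity in `p` of weak
`p`-summability. Part (iii) extracts a weakly convergent sequence from a weakly compact set of
functionals (`IsRelWeaklyCompact.exists_subseq`); the difference from its limit is weakly null,
hence uniformly small on a Dunford–Pettis range.

The rest uses Schur's theorem for `ℓ¹`-sums of finite-dimensional spaces
(`IsWeaklyNull.tendsto_tsum_norm`). One consequence is that weakly unconditionally Cauchy sequences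
have Dunford–Pettis range, so they are `1`-Right null.

For (vii), suppose bounded functionals `f n` on `C(Ω)` stay away from zero along a weakly null
sequence. Pass to variation measures. A disjointification argument of Rosenthal type
(`exists_subseq_sum_le_one`) gives functions with sums of absolute values at most one on which a
subsequence of `f n` still stays away from zero. Such functions form a weakly unconditionally Cauchy
sequence, so the `1`-(DPL) property already fails. The same argument shows that `C(Ω)` has the
Dunford–Pettis property.

For the converse in (v), take `1 ≤ p < q < ∞` and `E = ℓ^r` with `r` conjugate to `q`. Its unit
vectors are weakly `q`-summable, while weakly `p`-summable sequences are norm null. The unit vectors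
do not have Dunford–Pettis range in `E`, as the biorthogonal functionals are weakly null; so `E` is
enlarged (`exists_embedding_isDunfordPettisSet`). Glue to `E` an `ℓ¹`-sum of spaces `ℓ^∞_m` along
almost isometric copies of the spans of the first unit vectors. These pieces make the unit vectors
look as they do in a `C(Ω)` space, and the quotient by `E` has the Schur property, so no essentially
new weakly null sequences appear. The unit ball of the dual of the glued space is then the required
set. -/

theorem tendsto_biSup_enorm_iff {K : Set (X →L[ℝ] Y)} {x : ℕ → X} :
    Tendsto (fun n => ⨆ T ∈ K, ‖T (x n)‖ₑ) atTop (𝓝 0) ↔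
      ∀ ε : ℝ, 0 < ε → ∀ᶠ n in atTop, ∀ T ∈ K, ‖T (x n)‖ ≤ ε := by
  rw [ENNReal.tendsto_nhds_zero]
  constructor
  · intro h ε hε
    filter_upwards [h (ENNReal.ofReal ε) (by simpa using hε)] with n hn T hT
    have h1 : ‖T (x n)‖ₑ ≤ ENNReal.ofReal ε := (le_iSup₂_of_le T hT le_rfl).trans hn
    rwa [← ofReal_norm, ENNReal.ofReal_le_ofReal_iff hε.le] at h1
  · intro h ε hε
    rcases eq_or_ne ε ∞ with rfl | hε'
    · simp
    filter_upwards [h ε.toReal (ENNReal.toReal_pos hε.ne' hε')] with n hn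
    refine iSup₂_le fun T hT => ?_
    rw [← ofReal_norm]
    exact ENNReal.ofReal_le_of_le_toReal (hn T hT)

theorem isDPL_iff {p : ℝ≥0∞} {K : Set (X →L[ℝ] Y)} :
    IsDPL p K ↔ ∀ x : ℕ → X, IsRightNull p x →
      ∀ ε : ℝ, 0 < ε → ∀ᶠ n in atTop, ∀ T ∈ K, ‖T (x n)‖ ≤ ε := by
  simp only [IsDPL, tendsto_biSup_enorm_iff]

theorem IsDPL.subset_DPC {p : ℝ≥0∞} {K : Set (X →L[ℝ] Y)} (hK : IsDPL p K) {T : X →L[ℝ] Y}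
    (hT : T ∈ K) : T ∈ DPC p X Y := by
  intro x hx
  refine Metric.tendsto_nhds.2 fun ε hε => ?_
  filter_upwards [isDPL_iff.1 hK x hx (ε / 2) (half_pos hε)] with n hn
  rw [dist_zero_right]
  exact (hn T hT).trans_lt (half_lt_self hε)

/-- For fixed `n`, the operators with `‖T (x n)‖ ≤ ε` form a closed absolutely convex set, so the
bound passes to the hull with the same `n`. -/
theorem IsDPL.closedAbsConvexHull {p : ℝ≥0∞} {K : Set (X →L[ℝ] Y)} (hK : IsDPL p K) :
    IsDPL p (closedAbsConvexHull ℝ K) := by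
  rw [isDPL_iff] at hK ⊢
  intro x hx ε hε
  filter_upwards [hK x hx ε hε] with n hn
  let L : (X →L[ℝ] Y) →L[ℝ] Y := ContinuousLinearMap.apply ℝ Y (x n)
  have key : _root_.closedAbsConvexHull ℝ K ⊆ L ⁻¹' Metric.closedBall 0 ε := by
    refine closedAbsConvexHull_min (fun T hT => by simpa [L] using hn T hT) ⟨?_, ?_⟩
      (Metric.isClosed_closedBall.preimage L.continuous)
    · exact (balanced_closedBall_zero (𝕜 := ℝ) (r := ε)).mulActionHom_preimage
        (f := (L : (X →L[ℝ] Y) →ₗ[ℝ] Y).toMulActionHom)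
    · exact (convex_closedBall (0 : Y) ε).linear_preimage (L : (X →L[ℝ] Y) →ₗ[ℝ] Y)
  intro T hT
  simpa [L] using key hT

theorem isDPL_of_isRelCompact {p : ℝ≥0∞} {K : Set (X →L[ℝ] Y)} (hK : K ⊆ DPC p X Y)
    (hc : IsRelCompact K) : IsDPL p K := by
  rw [isDPL_iff]
  intro x hx ε hε
  obtain ⟨C, hC⟩ := hx.2.1.exists_norm_le
  have hC0 : 0 ≤ C := (norm_nonneg _).trans (hC (x 0) ⟨0, rfl⟩)
  have htb : TotallyBounded K := hc.totallyBounded.subset subset_closure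
  obtain ⟨t, htK, htf, ht⟩ := Metric.finite_approx_of_totallyBounded htb
    (ε / (2 * (C + 1))) (by positivity)
  have h1 : ∀ᶠ n in atTop, ∀ S ∈ t, ‖S (x n)‖ ≤ ε / 2 := by
    rw [htf.eventually_all]
    intro S hS
    have := (hK (htK hS) x hx).norm
    rw [norm_zero] at this
    exact this.eventually_le_const (half_pos hε)
  filter_upwards [h1] with n hn T hT
  obtain ⟨S, hS, hTS⟩ := Set.mem_iUnion₂.1 (ht hT)
  rw [Metric.mem_ball, dist_eq_norm] at hTS
  have h2 : ‖(T - S) (x n)‖ ≤ ε / 2 := by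
    refine ((T - S).le_opNorm _).trans ?_
    calc ‖T - S‖ * ‖x n‖ ≤ ε / (2 * (C + 1)) * (C + 1) := by
          gcongr
          linarith [hC (x n) ⟨n, rfl⟩]
      _ = ε / 2 := by field_simp
  have h3 : T (x n) = (T - S) (x n) + S (x n) := by simp
  rw [h3]
  linarith [norm_add_le ((T - S) (x n)) (S (x n)), hn S hS]

theorem mem_DPC_iff_isDPL_adjoint {p : ℝ≥0∞} (T : X →L[ℝ] Y) :
    T ∈ DPC p X Y ↔ IsDPL p (adjoint T '' Metric.closedBall (0 : StrongDual ℝ Y) 1) := by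
  rw [isDPL_iff]
  have happ : ∀ (g : StrongDual ℝ Y) (x : X), adjoint T g x = g (T x) := fun g x => rfl
  constructor
  · intro h x hx ε hε
    have h1 := (h x hx).norm
    rw [norm_zero] at h1
    filter_upwards [h1.eventually_le_const hε] with n hn
    rintro _ ⟨g, hg, rfl⟩
    rw [happ]
    have hg' : ‖g‖ ≤ 1 := by simpa using hg
    exact (g.le_of_opNorm_le hg' _).trans (by simpa using hn)
  · intro h x hx
    refine Metric.tendsto_nhds.2 fun ε hε => ?_
    filter_upwards [h x hx (ε / 2) (half_pos hε)] with n hn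
    obtain ⟨g, hg, hgT⟩ := exists_dual_vector'' ℝ (T (x n))
    have h2 := hn _ ⟨g, by simpa using hg, rfl⟩
    rw [happ, hgT] at h2
    rw [dist_zero_right]
    have h3 : ‖T (x n)‖ ≤ ε / 2 := by simpa using h2
    linarith

theorem IsWeaklyNull.comp {x : ℕ → X} (hx : IsWeaklyNull x) {k : ℕ → ℕ}
    (hk : Tendsto k atTop atTop) : IsWeaklyNull (x ∘ k) :=
  fun φ => (hx φ).comp hk

theorem IsWeaklyNull.map {x : ℕ → X} (hx : IsWeaklyNull x) (T : X →L[ℝ] Y) :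
    IsWeaklyNull (fun n => T (x n)) :=
  fun φ => hx (φ.comp T)

theorem IsWeaklyNull.exists_norm_le {x : ℕ → X} (hx : IsWeaklyNull x) : ∃ C, ∀ n, ‖x n‖ ≤ C := by
  obtain ⟨C, hC⟩ := banach_steinhaus
    (g := fun n => NormedSpace.inclusionInDoubleDual ℝ X (x n)) fun φ => by
      obtain ⟨C, hC⟩ := (hx φ).norm.bddAbove_range
      exact ⟨C, fun n => hC ⟨n, rfl⟩⟩
  exact ⟨C, fun n => ((NormedSpace.inclusionInDoubleDualLi ℝ (E := X)).norm_map (x n)).symm.trans_le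
    (hC n)⟩

theorem isWeaklySummable_top_iff {x : ℕ → X} : IsWeaklySummable ∞ x ↔ IsWeaklyNull x := by
  simp [IsWeaklySummable]

theorem isWeaklySummable_iff {p : ℝ≥0∞} (hp : p ≠ ∞) {x : ℕ → X} :
    IsWeaklySummable p x ↔ ∀ φ : StrongDual ℝ X, Memℓp (fun n => φ (x n)) p := by
  simp [IsWeaklySummable, hp]

theorem tendsto_zero_of_memℓp {p : ℝ≥0∞} (hp : p ≠ ∞) {a : ℕ → ℝ} (h : Memℓp a p) :
    Tendsto a atTop (𝓝 0) := by
  rcases eq_or_ne p 0 with rfl | h0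
  · have : Tendsto a cofinite (𝓝 0) := by
      refine tendsto_nhds_of_eventually_eq ?_
      simpa [Filter.eventually_cofinite] using h.finite_dsupport
    rwa [Nat.cofinite_eq_atTop] at this
  have hp0 : 0 < p.toReal := ENNReal.toReal_pos h0 hp
  have h1 := (h.summable hp0).tendsto_atTop_zero
  have h2 := h1.rpow_const (p := p.toReal⁻¹) (Or.inr (by positivity))
  rw [Real.zero_rpow (by positivity)] at h2
  refine tendsto_zero_iff_norm_tendsto_zero.2 (h2.congr fun n => ?_)
  rw [← Real.rpow_mul (norm_nonneg _), mul_inv_cancel₀ hp0.ne', Real.rpow_one]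

theorem IsWeaklySummable.isWeaklyNull {p : ℝ≥0∞} {x : ℕ → X} (hx : IsWeaklySummable p x) :
    IsWeaklyNull x := by
  rcases eq_or_ne p ∞ with rfl | hp
  · exact isWeaklySummable_top_iff.1 hx
  · exact fun φ => tendsto_zero_of_memℓp hp ((isWeaklySummable_iff hp).1 hx φ)

theorem IsWeaklySummable.mono {p q : ℝ≥0∞} (hpq : p ≤ q) {x : ℕ → X}
    (hx : IsWeaklySummable p x) : IsWeaklySummable q x := by
  rcases eq_or_ne q ∞ with rfl | hq
  · exact isWeaklySummable_top_iff.2 hx.isWeaklyNull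
  · exact (isWeaklySummable_iff hq).2 fun φ =>
      ((isWeaklySummable_iff (ne_top_of_le_ne_top hq hpq)).1 hx φ).of_exponent_ge hpq

theorem IsDPL.anti {p q : ℝ≥0∞} (hpq : p ≤ q) {K : Set (X →L[ℝ] Y)} (hK : IsDPL q K) :
    IsDPL p K :=
  fun x hx => hK x ⟨hx.1.mono hpq, hx.2⟩

/-- A weakly null sequence has Dunford-Pettis range as soon as weakly null sequences of functionals,
evaluated along weakly null sequences in this range, tend to zero. -/
theorem isDunfordPettisSet_range {x : ℕ → X} (hx : IsWeaklyNull x)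
    (h : ∀ φ : ℕ → StrongDual ℝ X, IsWeaklyNull φ → ∀ y : ℕ → X, IsWeaklyNull y →
      (∀ n, y n ∈ Set.range x) → Tendsto (fun n => φ n (y n)) atTop (𝓝 0)) :
    IsDunfordPettisSet (Set.range x) := by
  refine ⟨?_, fun φ hφ => ?_⟩
  · obtain ⟨C, hC⟩ := hx.exists_norm_le
    exact isBounded_iff_forall_norm_le.2 ⟨C, by rintro _ ⟨n, rfl⟩; exact hC n⟩
  rw [Metric.tendstoUniformlyOn_iff]
  by_contra! hcon
  obtain ⟨ε, hε, hf⟩ := hcon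
  obtain ⟨k, hk, hk'⟩ := extraction_of_frequently_atTop hf
  choose v hv hvε using hk'
  choose i hi using hv
  -- Each fixed `x n` is eventually mapped below `ε` by the functionals, so it can be a bad point
  -- only finitely often.
  have hi' : Tendsto i atTop atTop := by
    refine tendsto_atTop.2 fun N => ?_
    have h1 : ∀ᶠ m in atTop, ∀ n ∈ Finset.range N, |φ (k m) (x n)| < ε := by
      rw [Filter.eventually_all_finset]
      intro n _
      have h2 : Tendsto (fun m => φ (k m) (x n)) atTop (𝓝 0) :=
        (hφ.comp hk.tendsto_atTop) (NormedSpace.inclusionInDoubleDual ℝ X (x n))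
      have h3 := h2.abs
      rw [abs_zero] at h3
      exact h3.eventually_lt_const hε
    filter_upwards [h1] with m hm
    by_contra hlt
    have h4 := hm (i m) (Finset.mem_range.2 (not_le.1 hlt))
    have h5 := hvε m
    rw [← hi m, dist_comm, Real.dist_eq, sub_zero] at h5
    linarith
  have h6 := h (φ ∘ k) (hφ.comp hk.tendsto_atTop) (x ∘ i) (hx.comp hi') fun n => ⟨i n, rfl⟩
  have h7 := h6.abs
  rw [abs_zero] at h7
  obtain ⟨m, hm⟩ := (h7.eventually_lt_const hε).exists
  have h5 := hvε m
  rw [← hi m, dist_comm, Real.dist_eq, sub_zero] at h5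
  simp only [Function.comp] at hm
  linarith

end Basic

/-! ### Sequential extraction from weakly compact sets -/

section WeakCompactness

variable {X : Type*} [NormedAddCommGroup X] [NormedSpace ℝ X]

/-- Norming functionals of a dense sequence in the closed span suffice: if all of them kill `x`,
then any `f n` close to `x` has norm at most `‖x - f n‖`, which forces `x` to be small. -/
theorem exists_countable_separating_functionals (s : ℕ → X) :
    ∃ g : ℕ → StrongDual ℝ X, ∀ x ∈ (Submodule.span ℝ (Set.range s)).topologicalClosure,
      (∀ n, g n x = 0) → x = 0 := by
  set G : Submodule ℝ X := (Submodule.span ℝ (Set.range s)).topologicalClosure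
  have hsep : TopologicalSpace.IsSeparable (G : Set X) :=
    (TopologicalSpace.IsSeparable.span (Set.countable_range s).isSeparable).closure
  obtain ⟨d, hdG, hd⟩ := hsep.exists_countable_dense_subset
  obtain ⟨hdc, hd⟩ := hd
  have hdn : d.Nonempty := by
    by_contra h
    rw [Set.not_nonempty_iff_eq_empty] at h
    have := hd G.zero_mem
    simp [h] at this
  obtain ⟨f, rfl⟩ := hdc.exists_eq_range hdn
  choose g hg hgf using fun n => exists_dual_vector'' ℝ (f n)
  refine ⟨g, fun x hx h0 => ?_⟩
  by_contra hne
  have hpos : 0 < ‖x‖ := norm_pos_iff.2 hne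
  obtain ⟨_, ⟨n, rfl⟩, hn⟩ := Metric.mem_closure_iff.1 (hd hx) (‖x‖ / 4) (by positivity)
  rw [dist_eq_norm] at hn
  have h1 : ‖f n‖ ≤ ‖x - f n‖ := by
    have h2 : g n (f n - x) = ‖f n‖ := by
      rw [map_sub, h0 n, hgf n]; simp
    have h3 := (g n).le_of_opNorm_le (hg n) (f n - x)
    rw [h2, one_mul, norm_sub_rev, norm_norm] at h3
    exact h3
  have h4 : ‖x‖ ≤ ‖x - f n‖ + ‖f n‖ := by simpa using norm_add_le (x - f n) (f n)
  linarith

/-- Šmulian's half of the Eberlein–Šmulian theorem. -/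
theorem IsRelWeaklyCompact.exists_subseq {K : Set X} (hK : IsRelWeaklyCompact K) {f : ℕ → X}
    (hf : ∀ n, f n ∈ K) :
    ∃ (x : X) (k : ℕ → ℕ), StrictMono k ∧ IsWeaklyNull (fun n => f (k n) - x) := by
  obtain ⟨g, hg⟩ := exists_countable_separating_functionals f
  set G : Submodule ℝ X := (Submodule.span ℝ (Set.range f)).topologicalClosure
  -- Mazur: the norm-closed convex set `G` is weakly closed. Thus `H` is weakly compact, and
  -- countably many functionals separate its points, so it is metrizable and sequentially compact.
  have hGc : IsClosed (toWeakSpace ℝ X '' (G : Set X)) := by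
    have h1 : IsClosed (G : Set X) := Submodule.isClosed_topologicalClosure _
    have h2 := Convex.toWeakSpace_closure ℝ (Submodule.convex G)
    rw [h1.closure_eq] at h2
    rw [h2]
    exact isClosed_closure
  set H : Set (WeakSpace ℝ X) := closure (toWeakSpace ℝ X '' K) ∩ toWeakSpace ℝ X '' (G : Set X)
  have hHc : IsCompact H := hK.inter_right hGc
  have : CompactSpace H := isCompact_iff_compactSpace.1 hHc
  have heval : ∀ φ : StrongDual ℝ X, Continuous fun h : H => φ ((toWeakSpace ℝ X).symm h.1) :=
    fun φ => (WeakBilin.eval_continuous (topDualPairing ℝ X).flip φ).comp continuous_subtype_val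
  have : TopologicalSpace.MetrizableSpace H := by
    refine Metric.PiNatEmbed.TopologicalSpace.MetrizableSpace.of_countable_separating
      (X := H) (Y := fun _ => ℝ) (fun n h => g n ((toWeakSpace ℝ X).symm h.1))
      (fun n => heval (g n)) ?_
    rintro ⟨x, hx, x', hx', hxe⟩ ⟨y, hy, y', hy', hye⟩ hxy
    by_contra! hcon
    apply hxy
    have hsub : x' - y' = 0 := by
      refine hg _ (G.sub_mem hx' hy') fun n => ?_
      have := hcon n
      simp only [← hxe, ← hye, LinearEquiv.symm_apply_apply] at this
      rw [map_sub, this, sub_self]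
    refine Subtype.ext ?_
    change x = y
    rw [← hxe, ← hye, sub_eq_zero.1 hsub]
  have hfH : ∀ n, toWeakSpace ℝ X (f n) ∈ H := fun n =>
    ⟨subset_closure ⟨_, hf n, rfl⟩, ⟨_, Submodule.le_topologicalClosure _
      (Submodule.subset_span ⟨n, rfl⟩), rfl⟩⟩
  obtain ⟨a, k, hk, hlim⟩ := CompactSpace.tendsto_subseq (fun n => (⟨_, hfH n⟩ : H))
  refine ⟨(toWeakSpace ℝ X).symm a.1, k, hk, fun φ => ?_⟩
  have h := ((heval φ).tendsto a).comp hlim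
  have h' := h.sub_const (φ ((toWeakSpace ℝ X).symm a.1))
  rw [sub_self] at h'
  refine h'.congr fun n => ?_
  simp

/-- Otherwise some `f (l n)` converging weakly to `g` stay large along the sequence. But `f (l n) -
g` is small uniformly on its range, and `g` alone tends to zero along it. -/
theorem isDPL_of_isRelWeaklyCompact {p : ℝ≥0∞} {K : Set (StrongDual ℝ X)}
    (hK : IsRelWeaklyCompact K) : IsDPL p K := by
  rw [isDPL_iff]
  intro x hx ε hε
  by_contra hcon
  rw [not_eventually] at hcon
  obtain ⟨k, hk, hk'⟩ := extraction_of_frequently_atTop hcon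
  push Not at hk'
  choose f hfK hfε using hk'
  obtain ⟨g, l, hl, hg⟩ := hK.exists_subseq hfK
  have h1 := Metric.tendstoUniformlyOn_iff.1 (hx.2.2 _ hg) (ε / 2) (half_pos hε)
  have h2 : Tendsto (fun n => g (x (k (l n)))) atTop (𝓝 0) :=
    (hx.1.isWeaklyNull g).comp (hk.comp hl).tendsto_atTop
  have h3 := h2.norm
  rw [norm_zero] at h3
  obtain ⟨n, hn1, hn2⟩ := (h1.and (h3.eventually_lt_const (half_pos hε))).exists
  have h4 := hn1 (x (k (l n))) ⟨_, rfl⟩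
  rw [dist_zero_left, sub_apply] at h4
  have h5 := hfε (l n)
  have h6 : ‖f (l n) (x (k (l n)))‖ ≤ ‖f (l n) (x (k (l n))) - g (x (k (l n)))‖
      + ‖g (x (k (l n)))‖ := by
    simpa using norm_add_le (f (l n) (x (k (l n))) - g (x (k (l n)))) (g (x (k (l n))))
  linarith

end WeakCompactness

/-! ### Schur's theorem by Baire category, and weakly unconditionally Cauchy sequences -/

section Schur

theorem IsWeaklyNull.tendsto_of_finiteDimensional {D : Type*} [NormedAddCommGroup D]
    [NormedSpace ℝ D] [FiniteDimensional ℝ D] {x : ℕ → D} (hx : IsWeaklyNull x) :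
    Tendsto x atTop (𝓝 0) := by
  let b := Module.finBasis ℝ D
  have h : Tendsto (fun n => ∑ i, (b.coord i).toContinuousLinearMap (x n) • b i) atTop
      (𝓝 (∑ i, (0 : ℝ) • b i)) :=
    tendsto_finsetSum _ fun i _ => (hx _).smul_const _
  simp only [zero_smul, Finset.sum_const_zero] at h
  exact h.congr fun n => by simp [b.sum_repr]

variable {Z : Type*} [NormedAddCommGroup Z] [NormedSpace ℝ Z]
  {ι : Type*} {D : ι → Type*} [∀ j, NormedAddCommGroup (D j)] [∀ j, NormedSpace ℝ (D j)]

theorem summable_norm_of_sum_le {A : ∀ j, Z →L[ℝ] D j} {C : ℝ}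
    (hA : ∀ x, ∀ s : Finset ι, ∑ j ∈ s, ‖A j x‖ ≤ C * ‖x‖) (x : Z) :
    Summable fun j => ‖A j x‖ :=
  summable_of_sum_le (fun _ => norm_nonneg _) (hA x)

theorem abs_apply_le_norm {D : Type*} [NormedAddCommGroup D] [NormedSpace ℝ D]
    {ψ : StrongDual ℝ D} (hψ : ‖ψ‖ ≤ 1) (y : D) : ‖ψ y‖ ≤ ‖y‖ := by
  simpa using ψ.le_of_opNorm_le hψ y

/-- The functional on `Z` obtained from a bounded family of functionals on the factors of an
`ℓ¹`-type decomposition. -/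
noncomputable def sumFunctional (A : ∀ j, Z →L[ℝ] D j) (C : ℝ)
    (hA : ∀ x, ∀ s : Finset ι, ∑ j ∈ s, ‖A j x‖ ≤ C * ‖x‖)
    (ψ : ∀ j, StrongDual ℝ (D j)) (hψ : ∀ j, ‖ψ j‖ ≤ 1) : StrongDual ℝ Z :=
  LinearMap.mkContinuous
    { toFun := fun x => ∑' j, ψ j (A j x)
      map_add' := fun x y => by
        simp only [map_add]
        exact Summable.tsum_add
          (.of_norm_bounded (summable_norm_of_sum_le hA x) fun j => abs_apply_le_norm (hψ j) _)
          (.of_norm_bounded (summable_norm_of_sum_le hA y) fun j => abs_apply_le_norm (hψ j) _)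
      map_smul' := fun c x => by
        simp only [map_smul, smul_eq_mul, RingHom.id_apply]
        exact tsum_mul_left }
    C fun x => by
      refine (tsum_of_norm_bounded (summable_norm_of_sum_le hA x).hasSum
        fun j => abs_apply_le_norm (hψ j) _).trans ?_
      exact Real.tsum_le_of_sum_le (fun _ => norm_nonneg _) (hA x)

/-- Schur's theorem for `ℓ¹`-sums of finite-dimensional spaces. -/
theorem IsWeaklyNull.tendsto_tsum_norm [∀ j, FiniteDimensional ℝ (D j)]
    {A : ∀ j, Z →L[ℝ] D j} {C : ℝ}
    (hA : ∀ x, ∀ s : Finset ι, ∑ j ∈ s, ‖A j x‖ ≤ C * ‖x‖) {x : ℕ → Z} (hx : IsWeaklyNull x) :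
    Tendsto (fun n => ∑' j, ‖A j (x n)‖) atTop (𝓝 0) := by
  classical
  have hA' := summable_norm_of_sum_le hA
  have hcoord : ∀ j, Tendsto (fun n => ‖A j (x n)‖) atTop (𝓝 0) := fun j => by
    have := (hx.map (A j)).tendsto_of_finiteDimensional.norm
    rwa [norm_zero] at this
  refine Metric.tendsto_nhds.2 fun ε hε => ?_
  -- The product of the dual balls is compact, hence a Baire space, and each of its points sums to a
  -- functional on `Z`.
  let B : Type _ := ∀ j, Metric.closedBall (0 : StrongDual ℝ (D j)) 1
  have hB : ∀ (ψ : B) j, ‖(ψ j).1‖ ≤ 1 := fun ψ j => mem_closedBall_zero_iff.1 (ψ j).2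
  let Ψ : B → Z → ℝ := fun ψ z => ∑' j, (ψ j).1 (A j z)
  have hΨs : ∀ (ψ : B) z, Summable fun j => (ψ j).1 (A j z) := fun ψ z =>
    .of_norm_bounded (hA' z) fun j => abs_apply_le_norm (hB ψ j) _
  have hΨc : ∀ z, Continuous fun ψ => Ψ ψ z := fun z => by
    refine continuous_tsum (fun j => ?_) (hA' z) fun j ψ => abs_apply_le_norm (hB ψ j) _
    exact ((ContinuousLinearMap.apply ℝ ℝ (A j z)).continuous.comp
      continuous_subtype_val).comp (continuous_apply j)
  have hΨ0 : ∀ ψ : B, Tendsto (fun n => Ψ ψ (x n)) atTop (𝓝 0) := fun ψ =>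
    hx (sumFunctional A C hA (fun j => (ψ j).1) (hB ψ))
  let F : ℕ → Set B := fun k => {ψ | ∀ m, k ≤ m → |Ψ ψ (x m)| ≤ ε / 4}
  have hFc : ∀ k, IsClosed (F k) := fun k => by
    simp only [F, Set.ofPred_forall]
    exact isClosed_iInter fun m => isClosed_iInter fun _ =>
      isClosed_le (hΨc (x m)).abs continuous_const
  have hFU : ⋃ k, F k = Set.univ := by
    refine Set.eq_univ_of_forall fun ψ => ?_
    have h := (hΨ0 ψ).abs
    rw [abs_zero] at h
    obtain ⟨k, hk⟩ := eventually_atTop.1 (h.eventually_le_const (by positivity : 0 < ε / 4))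
    exact Set.mem_iUnion.2 ⟨k, hk⟩
  have : ∀ j, CompactSpace (Metric.closedBall (0 : StrongDual ℝ (D j)) 1) := fun j =>
    have : ProperSpace (StrongDual ℝ (D j)) := FiniteDimensional.proper_real _
    isCompact_iff_compactSpace.1 (isCompact_closedBall _ _)
  have : Nonempty B := ⟨fun j => ⟨0, by simp⟩⟩
  -- Baire: some `F k` has interior. A basic neighbourhood of `ψ₀` restricts only the finitely many
  -- coordinates in `I`; all others are free.
  obtain ⟨k, ψ₀, hψ₀⟩ := nonempty_interior_of_iUnion_of_closed hFc hFU
  obtain ⟨I, u, hu, hI⟩ := isOpen_pi_iff.1 isOpen_interior ψ₀ hψ₀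
  have hhead : Tendsto (fun n => ∑ j ∈ I, 2 * ‖A j (x n)‖) atTop (𝓝 0) := by
    have := tendsto_finsetSum I fun j _ => (hcoord j).const_mul 2
    simpa using this
  filter_upwards [hhead.eventually_lt_const (by positivity : 0 < ε / 4), eventually_ge_atTop k]
    with m hm hkm
  choose g hg hgA using fun j => exists_dual_vector'' ℝ (A j (x m))
  -- Keep `ψ₀` on `I` and norm every other coordinate of `x m`. Membership in `F k` then controls
  -- the tail of the norm sum, while the coordinates in `I` tend to zero by finite dimensionality.
  let ψ : B := fun j => if j ∈ I then ψ₀ j else ⟨g j, by simpa using hg j⟩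
  have hψF : ψ ∈ F k := by
    refine interior_subset (hI fun j hj => ?_)
    simp only [ψ, Finset.mem_coe.1 hj, if_true]
    exact (hu j hj).2
  have hsum : ∑' j, ‖A j (x m)‖ =
      ∑ j ∈ I, (‖A j (x m)‖ - (ψ₀ j).1 (A j (x m))) + Ψ ψ (x m) := by
    have h1 : ∀ j, ‖A j (x m)‖ =
        (if j ∈ I then ‖A j (x m)‖ - (ψ₀ j).1 (A j (x m)) else 0) + (ψ j).1 (A j (x m)) := by
      intro j
      by_cases hj : j ∈ I
      · simp [ψ, hj]
      · have := hgA j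
        simp only [RCLike.ofReal_real_eq_id, id] at this
        simp [ψ, hj, this]
    have h2 : HasSum (fun j => if j ∈ I then ‖A j (x m)‖ - (ψ₀ j).1 (A j (x m)) else 0)
        (∑ j ∈ I, (‖A j (x m)‖ - (ψ₀ j).1 (A j (x m)))) := by
      have h3 := hasSum_sum_of_ne_finset_zero (s := I) (L := SummationFilter.unconditional ι)
        (f := fun j => if j ∈ I then ‖A j (x m)‖ - (ψ₀ j).1 (A j (x m)) else 0)
        (fun j hj => if_neg hj)
      rwa [Finset.sum_congr (M := ℝ) rfl fun j hj => if_pos hj] at h3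
    rw [tsum_congr h1]
    exact (h2.add (hΨs ψ (x m)).hasSum).tsum_eq
  have hle : ∑ j ∈ I, (‖A j (x m)‖ - (ψ₀ j).1 (A j (x m))) ≤ ∑ j ∈ I, 2 * ‖A j (x m)‖ := by
    refine Finset.sum_le_sum fun j _ => ?_
    have := neg_le_of_abs_le (abs_apply_le_norm (hB ψ₀ j) (A j (x m)))
    linarith
  have hnn : 0 ≤ ∑' j, ‖A j (x m)‖ := tsum_nonneg fun _ => norm_nonneg _
  rw [Real.dist_0_eq_abs, abs_of_nonneg hnn, hsum]
  have := (abs_le.1 (hψF m hkm)).2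
  linarith

variable {X : Type*} [NormedAddCommGroup X] [NormedSpace ℝ X]

/-- The range of a weakly unconditionally Cauchy sequence is a Dunford-Pettis set. -/
theorem isDunfordPettisSet_range_of_sum_le {y : ℕ → X} {C : ℝ} (hC : 0 ≤ C)
    (hy : ∀ φ : StrongDual ℝ X, ∀ s : Finset ℕ, ∑ n ∈ s, ‖φ (y n)‖ ≤ C * ‖φ‖) :
    IsDunfordPettisSet (Set.range y) := by
  refine ⟨?_, fun φ hφ => ?_⟩
  · refine isBounded_iff_forall_norm_le.2 ⟨C, ?_⟩
    rintro _ ⟨n, rfl⟩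
    obtain ⟨g, hg, hgy⟩ := exists_dual_vector'' ℝ (y n)
    have h := hy g {n}
    rw [Finset.sum_singleton, hgy] at h
    have h1 : ‖y n‖ ≤ C * ‖g‖ := by simpa using h
    exact h1.trans (mul_le_of_le_one_right hC hg)
  · have h := hφ.tendsto_tsum_norm (D := fun _ : ℕ => ℝ)
      (A := fun n => NormedSpace.inclusionInDoubleDual ℝ X (y n)) hy
    have hs := summable_norm_of_sum_le (D := fun _ : ℕ => ℝ)
      (A := fun n => NormedSpace.inclusionInDoubleDual ℝ X (y n)) hy
    rw [Metric.tendstoUniformlyOn_iff]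
    intro ε hε
    filter_upwards [h.eventually_lt_const hε] with k hk
    rintro _ ⟨n, rfl⟩
    rw [dist_zero_left]
    exact ((hs (φ k)).le_tsum n fun _ _ => norm_nonneg _).trans_lt hk

theorem isWeaklySummable_one_of_sum_le {y : ℕ → X} {C : ℝ}
    (hy : ∀ φ : StrongDual ℝ X, ∀ s : Finset ℕ, ∑ n ∈ s, ‖φ (y n)‖ ≤ C * ‖φ‖) :
    IsWeaklySummable 1 y :=
  (isWeaklySummable_iff ENNReal.one_ne_top).2 fun φ =>
    memℓp_gen (by simpa using summable_of_sum_le (fun _ => norm_nonneg _) (hy φ))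

end Schur

/-! ### Variation measures of functionals on `C(Ω)` -/

section Variation

open scoped NNReal CompactlySupported

variable {Ω : Type*} [TopologicalSpace Ω] [CompactSpace Ω]

/-- The values of a functional on `C(Ω)` on the order interval `[-g, g]`. -/
def orderIntervalImage (f : StrongDual ℝ C(Ω, ℝ)) (g : Ω → ℝ) : Set ℝ :=
  f '' {z | ∀ ω, |z ω| ≤ g ω}

theorem orderIntervalImage_nonempty (f : StrongDual ℝ C(Ω, ℝ)) {g : Ω → ℝ} (hg : 0 ≤ g) :
    (orderIntervalImage f g).Nonempty :=
  ⟨0, 0, fun ω => by simpa using hg ω, map_zero f⟩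

theorem orderIntervalImage_le (f : StrongDual ℝ C(Ω, ℝ)) {g : Ω → ℝ} {M : ℝ} (hM : 0 ≤ M)
    (hg : ∀ ω, g ω ≤ M) : ∀ r ∈ orderIntervalImage f g, r ≤ ‖f‖ * M := by
  rintro _ ⟨z, hz, rfl⟩
  refine (le_abs_self _).trans (f.le_opNorm_of_le ?_)
  exact (ContinuousMap.norm_le _ hM).2 fun ω => (hz ω).trans (hg ω)

theorem orderIntervalImage_bddAbove (f : StrongDual ℝ C(Ω, ℝ)) {g : Ω → ℝ} (hg : Continuous g) :
    BddAbove (orderIntervalImage f g) :=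
  ⟨_, orderIntervalImage_le f (norm_nonneg (⟨g, hg⟩ : C(Ω, ℝ)))
    fun ω => (le_abs_self _).trans ((⟨g, hg⟩ : C(Ω, ℝ)).norm_coe_le_norm ω)⟩

open scoped Pointwise in
theorem orderIntervalImage_add (f : StrongDual ℝ C(Ω, ℝ)) {g h : Ω → ℝ} (hg0 : 0 ≤ g)
    (hg : Continuous g) (hh0 : 0 ≤ h) :
    orderIntervalImage f (g + h) = orderIntervalImage f g + orderIntervalImage f h := by
  ext r
  simp only [Set.mem_add, orderIntervalImage, Set.mem_image, Set.mem_ofPred_eq]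
  constructor
  · rintro ⟨z, hz, rfl⟩
    -- Riesz decomposition: truncate `z` to `[-g, g]`; the remainder lies in `[-h, h]`.
    let u : C(Ω, ℝ) := ⟨fun ω => max (-g ω) (min (z ω) (g ω)), by fun_prop⟩
    have hu : ∀ ω, |u ω| ≤ g ω ∧ |(z - u) ω| ≤ h ω := fun ω => by
      have h1 := hg0 ω
      have h2 := hh0 ω
      have h3 := abs_le.1 (hz ω)
      simp only [Pi.zero_apply, Pi.add_apply] at h1 h2 h3
      simp only [ContinuousMap.sub_apply, u, ContinuousMap.coe_mk, abs_le]
      rcases le_total (z ω) (g ω) with h4 | h4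
      · rw [min_eq_left h4]
        rcases le_total (-g ω) (z ω) with h5 | h5
        · rw [max_eq_right h5]
          constructor <;> constructor <;> linarith
        · rw [max_eq_left h5]
          constructor <;> constructor <;> linarith
      · rw [min_eq_right h4, max_eq_right (by linarith)]
        constructor <;> constructor <;> linarith
    exact ⟨_, ⟨u, fun ω => (hu ω).1, rfl⟩, _, ⟨z - u, fun ω => (hu ω).2, rfl⟩, by
      rw [map_sub]; ring⟩
  · rintro ⟨_, ⟨u, hu, rfl⟩, _, ⟨v, hv, rfl⟩, rfl⟩
    exact ⟨u + v, fun ω => (abs_add_le _ _).trans (add_le_add (hu ω) (hv ω)), map_add f u v⟩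

open scoped Pointwise in
theorem orderIntervalImage_smul (f : StrongDual ℝ C(Ω, ℝ)) {g : Ω → ℝ} {c : ℝ} (hc : 0 < c) :
    orderIntervalImage f (c • g) = c • orderIntervalImage f g := by
  ext r
  simp only [Set.mem_smul_set, orderIntervalImage, Set.mem_image, Set.mem_ofPred_eq]
  constructor
  · rintro ⟨z, hz, rfl⟩
    refine ⟨_, ⟨c⁻¹ • z, fun ω => ?_, rfl⟩, ?_⟩
    · have := hz ω
      rw [ContinuousMap.smul_apply, smul_eq_mul, abs_mul, abs_of_pos (inv_pos.2 hc),
        inv_mul_le_iff₀ hc]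
      exact this
    · rw [map_smul, smul_smul, mul_inv_cancel₀ hc.ne', one_smul]
  · rintro ⟨_, ⟨z, hz, rfl⟩, rfl⟩
    refine ⟨c • z, fun ω => ?_, map_smul f c z⟩
    rw [ContinuousMap.smul_apply, smul_eq_mul, abs_mul, abs_of_pos hc]
    exact mul_le_mul_of_nonneg_left (hz ω) hc.le

theorem sSup_orderIntervalImage_nonneg (f : StrongDual ℝ C(Ω, ℝ)) {g : Ω → ℝ} (hg0 : 0 ≤ g)
    (hg : Continuous g) : 0 ≤ sSup (orderIntervalImage f g) :=
  le_csSup (orderIntervalImage_bddAbove f hg) ⟨0, fun ω => by simpa using hg0 ω, map_zero f⟩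

/-- The modulus of a functional on `C(Ω)`, as a functional on the positive cone. -/
noncomputable def modulus (f : StrongDual ℝ C(Ω, ℝ)) : C_c(Ω, ℝ≥0) →ₗ[ℝ≥0] ℝ≥0 where
  toFun g := (sSup (orderIntervalImage f fun ω => (g ω : ℝ))).toNNReal
  map_add' g h := by
    have h1 : (fun ω => ((g + h) ω : ℝ)) = (fun ω => (g ω : ℝ)) + fun ω => (h ω : ℝ) := by
      ext ω; simp
    rw [h1, orderIntervalImage_add f (fun ω => (g ω).coe_nonneg) (by fun_prop) (fun ω => (h ω).coe_nonneg),
      csSup_add (orderIntervalImage_nonempty f fun ω => (g ω).coe_nonneg)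
        (orderIntervalImage_bddAbove f (by fun_prop))
        (orderIntervalImage_nonempty f fun ω => (h ω).coe_nonneg)
        (orderIntervalImage_bddAbove f (by fun_prop)),
      Real.toNNReal_add (sSup_orderIntervalImage_nonneg f (fun ω => (g ω).coe_nonneg) (by fun_prop))
        (sSup_orderIntervalImage_nonneg f (fun ω => (h ω).coe_nonneg) (by fun_prop))]
  map_smul' c g := by
    have h1 : (fun ω => ((c • g) ω : ℝ)) = (c : ℝ) • fun ω => (g ω : ℝ) := by
      ext ω; simp
    rw [h1, RingHom.id_apply]
    rcases eq_or_ne c 0 with rfl | hc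
    · rw [NNReal.coe_zero, zero_smul, zero_smul, Real.toNNReal_eq_zero]
      refine csSup_le (orderIntervalImage_nonempty f le_rfl) fun r hr => ?_
      simpa using orderIntervalImage_le f le_rfl (fun _ => le_rfl) r hr
    · rw [orderIntervalImage_smul f (NNReal.coe_pos.2 (pos_iff_ne_zero.2 hc)),
        Real.sSup_smul_of_nonneg c.coe_nonneg, smul_eq_mul, smul_eq_mul, Real.toNNReal_mul c.coe_nonneg,
        Real.toNNReal_coe]

variable [T2Space Ω] [MeasurableSpace Ω] [BorelSpace Ω]

/-- The variation measure of a functional on `C(Ω)`. -/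
theorem exists_variation_measure (f : StrongDual ℝ C(Ω, ℝ)) :
    ∃ μ : Measure Ω, IsFiniteMeasure μ ∧ ∀ g : C(Ω, ℝ), 0 ≤ g →
      IsLUB (orderIntervalImage f g) (∫ ω, g ω ∂μ) := by
  set μ := NNRealRMK.rieszMeasure (modulus f)
  have hμ : ∀ g : C_c(Ω, ℝ≥0), ∫ ω, (g ω : ℝ) ∂μ = sSup (orderIntervalImage f fun ω => (g ω : ℝ)) :=
    fun g => by
      rw [NNRealRMK.integral_rieszMeasure]
      exact Real.coe_toNNReal _
        (sSup_orderIntervalImage_nonneg f (fun ω => (g ω).coe_nonneg) (by fun_prop))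
  refine ⟨μ, ⟨?_⟩, fun g hg => ?_⟩
  · have h := NNRealRMK.lintegral_rieszMeasure (modulus f)
      (CompactlySupportedContinuousMap.continuousMapEquiv (1 : C(Ω, ℝ≥0)))
    simp only [CompactlySupportedContinuousMap.continuousMapEquiv_apply_toFun,
      ContinuousMap.one_apply, ENNReal.coe_one, lintegral_one] at h
    change μ Set.univ < ∞
    erw [h]
    exact ENNReal.coe_lt_top
  · let g' : C_c(Ω, ℝ≥0) := CompactlySupportedContinuousMap.continuousMapEquiv
      (⟨fun ω => (g ω).toNNReal, by fun_prop⟩ : C(Ω, ℝ≥0))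
    have hg' : (fun ω => (g' ω : ℝ)) = g := by
      ext ω
      exact Real.coe_toNNReal _ (hg ω)
    have h := hμ g'
    have h2 : ∫ ω, (g' ω : ℝ) ∂μ = ∫ ω, g ω ∂μ := congrArg (fun u : Ω → ℝ => ∫ ω, u ω ∂μ) hg'
    rw [h2, hg'] at h
    rw [h]
    exact isLUB_csSup (orderIntervalImage_nonempty f hg)
      (orderIntervalImage_bddAbove f g.continuous)

/-- A weakly null sequence is bounded and, testing with point evaluations, pointwise null; dominated
convergence applies. -/
theorem IsWeaklyNull.tendsto_integral_abs {x : ℕ → C(Ω, ℝ)} (hx : IsWeaklyNull x)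
    (μ : Measure Ω) [IsFiniteMeasure μ] :
    Tendsto (fun n => ∫ ω, |x n ω| ∂μ) atTop (𝓝 0) := by
  obtain ⟨C, hC⟩ := hx.exists_norm_le
  have h : Tendsto (fun n => ∫ ω, |x n ω| ∂μ) atTop (𝓝 (∫ _, (0 : ℝ) ∂μ)) := by
    refine tendsto_integral_of_dominated_convergence (fun _ => C) (fun n => ?_)
      (integrable_const C) (fun n => ?_) ?_
    · exact (x n).continuous.abs.aestronglyMeasurable
    · exact Eventually.of_forall fun ω => by
        simpa using ((x n).norm_coe_le_norm ω).trans (hC n)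
    · refine Eventually.of_forall fun ω => ?_
      have h1 := (hx (ContinuousMap.evalCLM ℝ ω)).abs
      rwa [abs_zero] at h1
  simpa using h

end Variation

/-! ### Disjointification against a bounded sequence of measures -/

section Disjointification

/-- The terms telescope: each is the difference of two consecutive products, so the sum is `1 - ∏ (1
- h j)`. The same identity bounds the loss in replacing `h n` by its product. -/
theorem mul_prod_one_sub_bounds {h : ℕ → ℝ} (h0 : ∀ n, 0 ≤ h n) (h1 : ∀ n, h n ≤ 1) (n : ℕ) :
    0 ≤ h n * ∏ j ∈ Finset.range n, (1 - h j) ∧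
    ∑ j ∈ Finset.range n, h j * ∏ i ∈ Finset.range j, (1 - h i) ≤ 1 ∧
    h n - ∑ j ∈ Finset.range n, h j ≤ h n * ∏ j ∈ Finset.range n, (1 - h j) := by
  have hp0 : ∀ n, 0 ≤ ∏ j ∈ Finset.range n, (1 - h j) := fun n =>
    Finset.prod_nonneg fun j _ => sub_nonneg.2 (h1 j)
  have hp1 : ∀ n, ∏ j ∈ Finset.range n, (1 - h j) ≤ 1 := fun n =>
    Finset.prod_le_one (fun j _ => sub_nonneg.2 (h1 j)) fun j _ => sub_le_self _ (h0 j)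
  have htel : ∀ n, ∑ j ∈ Finset.range n, h j * ∏ i ∈ Finset.range j, (1 - h i) =
      1 - ∏ j ∈ Finset.range n, (1 - h j) := fun n => by
    induction n with
    | zero => simp
    | succ n ih => rw [Finset.sum_range_succ, ih, Finset.prod_range_succ]; ring
  refine ⟨mul_nonneg (h0 n) (hp0 n), by rw [htel]; linarith [hp0 n], ?_⟩
  have h2 : ∑ j ∈ Finset.range n, h j * ∏ i ∈ Finset.range j, (1 - h i) ≤
      ∑ j ∈ Finset.range n, h j :=
    Finset.sum_le_sum fun j _ => mul_le_of_le_one_right (h0 j) (hp1 j)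
  rw [htel] at h2
  nlinarith [h0 n, h1 n, hp1 n]

variable {Ω : Type*} [TopologicalSpace Ω] [CompactSpace Ω] [MeasurableSpace Ω] [BorelSpace Ω]

/-- Multiplying by the complements of the previous functions makes a sequence of functions with
values in `[0, 1]` have sum at most one. -/
def disjointify (h : ℕ → C(Ω, ℝ)) (n : ℕ) : C(Ω, ℝ) :=
  h n * ∏ j ∈ Finset.range n, (1 - h j)

theorem disjointify_apply (h : ℕ → C(Ω, ℝ)) (n : ℕ) (ω : Ω) :
    disjointify h n ω = h n ω * ∏ j ∈ Finset.range n, (1 - h j ω) := by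
  simp [disjointify, ContinuousMap.coe_prod]

theorem integral_disjointify_ge {h : ℕ → C(Ω, ℝ)} (h0 : ∀ n ω, 0 ≤ h n ω) (h1 : ∀ n ω, h n ω ≤ 1)
    (μ : Measure Ω) [IsFiniteMeasure μ] (n : ℕ) :
    ∫ ω, h n ω ∂μ - ∑ j ∈ Finset.range n, ∫ ω, h j ω ∂μ ≤ ∫ ω, disjointify h n ω ∂μ := by
  rw [← integral_finsetSum _ fun j _ => integrable_continuousMap μ (h j),
    ← integral_sub (integrable_continuousMap μ (h n))
      (integrable_finsetSum _ fun j _ => integrable_continuousMap μ (h j))]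
  refine integral_mono ((integrable_continuousMap μ (h n)).sub
      (integrable_finsetSum _ fun j _ => integrable_continuousMap μ (h j)))
    (integrable_continuousMap μ _) fun ω => ?_
  simp only [disjointify_apply]
  exact (mul_prod_one_sub_bounds (fun n => h0 n ω) (fun n => h1 n ω) n).2.2

theorem exists_seq_integral_le {μ : ℕ → Measure Ω} {g : ℕ → C(Ω, ℝ)}
    (hlim : ∀ i, Tendsto (fun j => ∫ ω, g j ω ∂μ i) atTop (𝓝 0)) {I : Set ℕ} (hI : I.Infinite)
    {η : ℝ} (hη : 0 < η) :
    ∃ φ : ℕ → ℕ, (∀ n, φ n ∈ I) ∧ ∀ a b, a < b → ∫ ω, g (φ b) ω ∂μ (φ a) ≤ η := by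
  obtain ⟨φ, h1, h2⟩ := exists_seq_of_forall_finset_exists (fun i => i ∈ I)
    (fun a b => ∫ ω, g b ω ∂μ a ≤ η) fun s _ => by
      have h3 : ∀ᶠ j in atTop, ∀ i ∈ s, ∫ ω, g j ω ∂μ i ≤ η := by
        rw [Filter.eventually_all_finset]
        exact fun i _ => (hlim i).eventually_le_const hη
      obtain ⟨j, hjI, hj⟩ := ((Nat.frequently_atTop_iff_infinite.2 hI).and_eventually h3).exists
      exact ⟨j, hjI, hj⟩
  exact ⟨φ, h1, h2⟩

/-- A pigeonhole step. Among `N > C / η` functions whose sum is at most one, every measure of mass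
at most `C` gives some function integral at most `η`; infinitely many measures must then share the
same function. -/
theorem exists_large_integral_and_infinite_small {μ : ℕ → Measure Ω} [∀ i, IsFiniteMeasure (μ i)]
    {C : ℝ} (hμ : ∀ i, (μ i).real Set.univ ≤ C) {g : ℕ → C(Ω, ℝ)} (g0 : ∀ n ω, 0 ≤ g n ω)
    (g1 : ∀ n ω, g n ω ≤ 1) {ε : ℝ} (hε : 0 < ε) (hg : ∀ n, ε ≤ ∫ ω, g n ω ∂μ n)
    (hlim : ∀ i, Tendsto (fun j => ∫ ω, g j ω ∂μ i) atTop (𝓝 0))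
    {I : Set ℕ} (hI : I.Infinite) {η : ℝ} (hη : 0 < η) :
    ∃ k ∈ I, ∃ u : C(Ω, ℝ), (∀ ω, 0 ≤ u ω) ∧ (∀ ω, u ω ≤ 1) ∧ ε / 2 ≤ ∫ ω, u ω ∂μ k ∧
      ∃ J ⊆ I, J.Infinite ∧ ∀ i ∈ J, k < i ∧ ∫ ω, u ω ∂μ i ≤ η := by
  obtain ⟨N, hN⟩ := exists_nat_gt (C / η)
  have hC : 0 ≤ C := measureReal_nonneg.trans (hμ 0)
  have hN0 : (0 : ℝ) < N := (div_nonneg hC hη.le).trans_lt hN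
  obtain ⟨φ, hφI, hφ⟩ := exists_seq_integral_le hlim hI (η := ε / (2 * N)) (by positivity)
  -- The order is reversed: `φ` makes later functions small for earlier measures, whereas
  -- disjointification removes the preceding functions.
  let h : ℕ → C(Ω, ℝ) := fun a => g (φ (N - 1 - a))
  let y : ℕ → C(Ω, ℝ) := disjointify h
  have hb := fun n ω => mul_prod_one_sub_bounds (h := fun n => h n ω) (fun n => g0 _ ω)
    (fun n => g1 _ ω) n
  have hy0 : ∀ n ω, 0 ≤ y n ω := fun n ω => by
    simp only [y, disjointify_apply]; exact (hb n ω).1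
  have hysum : ∀ n ω, ∑ j ∈ Finset.range n, y j ω ≤ 1 := fun n ω => by
    simp only [y, disjointify_apply]; exact (hb n ω).2.1
  have hy1 : ∀ n ω, y n ω ≤ 1 := fun n ω =>
    (Finset.single_le_sum (f := fun j => y j ω) (fun j _ => hy0 j ω)
      (Finset.self_mem_range_succ n)).trans (hysum (n + 1) ω)
  have hlarge : ∀ a < N, ε / 2 ≤ ∫ ω, y a ω ∂μ (φ (N - 1 - a)) := by
    intro a ha
    refine le_trans ?_ (integral_disjointify_ge (fun n ω => g0 _ ω) (fun n ω => g1 _ ω) _ a)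
    have h1 : ∑ j ∈ Finset.range a, ∫ ω, h j ω ∂μ (φ (N - 1 - a)) ≤ a * (ε / (2 * N)) := by
      refine (Finset.sum_le_card_nsmul _ _ (ε / (2 * N)) fun j hj => ?_).trans_eq (by simp)
      have := Finset.mem_range.1 hj
      exact hφ _ _ (by omega)
    have h2 : (a : ℝ) * (ε / (2 * N)) ≤ N * (ε / (2 * N)) := by gcongr
    have h3 : N * (ε / (2 * N)) = ε / 2 := by field_simp
    have h4 : ε ≤ ∫ ω, h a ω ∂μ (φ (N - 1 - a)) := hg _
    linarith
  have hex : ∀ i, ∃ a < N, ∫ ω, y a ω ∂μ i ≤ η := by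
    intro i
    by_contra! hcon
    have h1 : ∑ a ∈ Finset.range N, ∫ ω, y a ω ∂μ i ≤ C := by
      rw [← integral_finsetSum _ fun j _ => integrable_continuousMap (μ i) (y j)]
      refine (integral_mono (integrable_finsetSum _ fun j _ => integrable_continuousMap (μ i) (y j))
        (integrable_const (1 : ℝ)) fun ω => hysum N ω).trans ?_
      simpa using hμ i
    have h2 : N * η ≤ ∑ a ∈ Finset.range N, ∫ ω, y a ω ∂μ i := by
      simpa using Finset.card_nsmul_le_sum (Finset.range N) (fun a => ∫ ω, y a ω ∂μ i) η
        fun a ha => (hcon a (Finset.mem_range.1 ha)).le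
    have h3 := (div_lt_iff₀ hη).1 hN
    linarith
  obtain ⟨a, haN, ha⟩ : ∃ a < N, {i ∈ I | ∫ ω, y a ω ∂μ i ≤ η}.Infinite := by
    by_contra! hcon
    refine hI (((Set.finite_lt_nat N).biUnion fun a ha => hcon a ha).subset ?_)
    intro i hi
    obtain ⟨a, ha, hai⟩ := hex i
    exact Set.mem_biUnion ha ⟨hi, hai⟩
  refine ⟨φ (N - 1 - a), hφI _, y a, hy0 a, hy1 a, hlarge a haN,
    {i ∈ I | ∫ ω, y a ω ∂μ i ≤ η} \ Set.Iic (φ (N - 1 - a)), fun i hi => hi.1.1,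
    ha.sdiff (Set.finite_Iic _), fun i hi => ⟨not_le.1 hi.2, hi.1.2⟩⟩

/-- Iterating the pigeonhole step makes every chosen function small for all later chosen measures,
with errors `ε / 4 * (1 / 2) ^ (n + 1)`. A second disjointification therefore costs at most `ε / 4`
out of `ε / 2`. -/
theorem exists_subseq_sum_le_one {μ : ℕ → Measure Ω} [∀ i, IsFiniteMeasure (μ i)]
    {C : ℝ} (hμ : ∀ i, (μ i).real Set.univ ≤ C) {g : ℕ → C(Ω, ℝ)} (g0 : ∀ n ω, 0 ≤ g n ω)
    (g1 : ∀ n ω, g n ω ≤ 1) {ε : ℝ} (hε : 0 < ε) (hg : ∀ n, ε ≤ ∫ ω, g n ω ∂μ n)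
    (hlim : ∀ i, Tendsto (fun j => ∫ ω, g j ω ∂μ i) atTop (𝓝 0)) :
    ∃ k : ℕ → ℕ, StrictMono k ∧ ∃ y : ℕ → C(Ω, ℝ), (∀ n ω, 0 ≤ y n ω) ∧
      (∀ n ω, ∑ j ∈ Finset.range n, y j ω ≤ 1) ∧ ∀ n, ε / 4 ≤ ∫ ω, y n ω ∂μ (k n) := by
  have step : ∀ (I : {I : Set ℕ // I.Infinite}) (n : ℕ), _ := fun I n =>
    exists_large_integral_and_infinite_small hμ g0 g1 hε hg hlim I.2
      (by positivity : 0 < ε / 4 * (1 / 2) ^ (n + 1))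
  choose K hKI u hu0 hu1 huK J hJI hJ hJK using step
  let S : ℕ → {I : Set ℕ // I.Infinite} := fun n =>
    Nat.rec ⟨Set.univ, Set.infinite_univ⟩ (fun n I => ⟨J I n, hJ I n⟩) n
  have hS : ∀ n, (S (n + 1)).1 = J (S n) n := fun n => rfl
  have hSanti : Antitone fun n => (S n).1 := antitone_nat_of_succ_le fun n => hJI (S n) n
  let k : ℕ → ℕ := fun n => K (S n) n
  let h : ℕ → C(Ω, ℝ) := fun n => u (S n) n
  have hkmem : ∀ m n, m < n → k n ∈ J (S m) m := fun m n hmn =>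
    hS m ▸ hSanti (Nat.succ_le_of_lt hmn) (hKI (S n) n)
  have hh0 : ∀ n ω, 0 ≤ h n ω := fun n => hu0 _ _
  have hh1 : ∀ n ω, h n ω ≤ 1 := fun n => hu1 _ _
  have hb := fun n ω => mul_prod_one_sub_bounds (h := fun n => h n ω) (fun n => hh0 _ ω)
    (fun n => hh1 _ ω) n
  refine ⟨k, strictMono_nat_of_lt_succ fun n => (hJK _ _ _ (hkmem n (n + 1) n.lt_succ_self)).1,
    disjointify h, fun n ω => ?_, fun n ω => ?_, fun n => ?_⟩
  · rw [disjointify_apply]; exact (hb n ω).1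
  · simp only [disjointify_apply]; exact (hb n ω).2.1
  · refine le_trans ?_ (integral_disjointify_ge hh0 hh1 _ n)
    have h1 : ∑ j ∈ Finset.range n, ∫ ω, h j ω ∂μ (k n) ≤ ε / 4 := by
      calc ∑ j ∈ Finset.range n, ∫ ω, h j ω ∂μ (k n)
          ≤ ∑ j ∈ Finset.range n, ε / 4 * (1 / 2) ^ (j + 1) :=
            Finset.sum_le_sum fun j hj => (hJK _ _ _ (hkmem j n (Finset.mem_range.1 hj))).2
        _ = ε / 4 * (1 - (1 / 2) ^ n) := by
            rw [← Finset.mul_sum]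
            congr 1
            induction n with
            | zero => simp
            | succ n ih => rw [Finset.sum_range_succ, ih]; ring
        _ ≤ ε / 4 := mul_le_of_le_one_right (by positivity) (sub_le_self _ (by positivity))
    have h2 : ε / 2 ≤ ∫ ω, h n ω ∂μ (k n) := huK _ _
    linarith

end Disjointification

/-! ### The Dunford–Pettis property of `C(Ω)` and part (vii) -/

section ContinuousFunctions

variable {Ω : Type*} [TopologicalSpace Ω] [CompactSpace Ω]

theorem sum_norm_apply_le_of_sum_abs_le_one {y : ℕ → C(Ω, ℝ)}
    (hy : ∀ n ω, ∑ j ∈ Finset.range n, |y j ω| ≤ 1) (φ : StrongDual ℝ C(Ω, ℝ)) (s : Finset ℕ) :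
    ∑ n ∈ s, ‖φ (y n)‖ ≤ 1 * ‖φ‖ := by
  -- Absorb the signs into the functions; the signed sum still has sup norm at most one.
  have h1 : ∑ n ∈ s, ‖φ (y n)‖ = φ (∑ n ∈ s, (SignType.sign (φ (y n)) : ℝ) • y n) := by
    rw [map_sum]
    refine Finset.sum_congr rfl fun n _ => ?_
    rw [map_smul, smul_eq_mul, sign_mul_self, Real.norm_eq_abs]
  rw [h1, one_mul]
  refine (le_abs_self _).trans ((φ.le_opNorm_of_le (c := 1) ?_).trans_eq (mul_one _))
  refine (ContinuousMap.norm_le _ zero_le_one).2 fun ω => ?_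
  obtain ⟨N, hN⟩ := s.exists_nat_subset_range
  rw [ContinuousMap.sum_apply]
  refine (norm_sum_le _ _).trans (le_trans ?_ (hy N ω))
  refine le_trans (Finset.sum_le_sum fun n _ => ?_)
    (Finset.sum_le_sum_of_subset_of_nonneg hN fun n _ _ => abs_nonneg (y n ω))
  rw [ContinuousMap.smul_apply, smul_eq_mul, norm_mul, Real.norm_eq_abs, Real.norm_eq_abs]
  refine mul_le_of_le_one_left (abs_nonneg _) ?_
  rcases SignType.sign (φ (y n)) with _ | _ | _ <;> simp

variable [T2Space Ω]

/-- If bounded functionals `f n` on `C(Ω)` do not vanish along a weakly null sequence, then they do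
not vanish along a weakly unconditionally Cauchy sequence either. -/
theorem exists_sum_abs_le_one_of_le_apply {f : ℕ → StrongDual ℝ C(Ω, ℝ)} {C : ℝ}
    (hf : ∀ n, ‖f n‖ ≤ C) {x : ℕ → C(Ω, ℝ)} (hx : IsWeaklyNull x) {ε : ℝ} (hε : 0 < ε)
    (hfx : ∀ n, ε ≤ |f n (x n)|) :
    ∃ δ > 0, ∃ k : ℕ → ℕ, StrictMono k ∧ ∃ y : ℕ → C(Ω, ℝ),
      (∀ n ω, ∑ j ∈ Finset.range n, |y j ω| ≤ 1) ∧ ∀ n, δ ≤ f (k n) (y n) := by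
  let _ : MeasurableSpace Ω := borel Ω
  have : BorelSpace Ω := ⟨rfl⟩
  choose μ hμfin hμ using fun n => exists_variation_measure (f n)
  obtain ⟨M', hM'⟩ := hx.exists_norm_le
  obtain ⟨M, hM0, hM⟩ : ∃ M > 0, ∀ n, ‖x n‖ ≤ M :=
    ⟨max M' 1, by positivity, fun n => (hM' n).trans (le_max_left _ _)⟩
  let g : ℕ → C(Ω, ℝ) := fun n => M⁻¹ • |x n|
  have hgapp : ∀ n ω, g n ω = M⁻¹ * |x n ω| := fun n ω => rfl
  have g0 : ∀ n ω, 0 ≤ g n ω := fun n ω => by rw [hgapp]; positivity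
  have g1 : ∀ n ω, g n ω ≤ 1 := fun n ω => by
    rw [hgapp, inv_mul_le_iff₀ hM0, mul_one]
    exact ((x n).norm_coe_le_norm ω).trans (hM n)
  have hgint : ∀ n i, ∫ ω, g n ω ∂μ i = M⁻¹ * ∫ ω, |x n ω| ∂μ i := fun n i => by
    simp only [hgapp]; exact integral_const_mul _ _
  have hmass : ∀ i, (μ i).real Set.univ ≤ C := fun i => by
    have h1 := (hμ i 1 zero_le_one).2 (orderIntervalImage_le (f i) zero_le_one fun _ => le_rfl)
    have h2 : ∫ ω, (1 : C(Ω, ℝ)) ω ∂μ i = (μ i).real Set.univ := by simp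
    rw [h2, mul_one] at h1
    exact h1.trans (hf i)
  have hlarge : ∀ n, ε / M ≤ ∫ ω, g n ω ∂μ n := fun n => by
    rw [hgint, div_eq_inv_mul]
    refine mul_le_mul_of_nonneg_left ((hfx n).trans ?_) (by positivity)
    have hub := (hμ n |x n| (abs_nonneg (x n))).1
    refine abs_le'.2 ⟨hub ⟨x n, fun ω => le_rfl, rfl⟩, hub ⟨-x n, fun ω => ?_, map_neg _ _⟩⟩
    exact (abs_neg (x n ω)).le
  have hlim : ∀ i, Tendsto (fun j => ∫ ω, g j ω ∂μ i) atTop (𝓝 0) := fun i => by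
    simp only [hgint]
    simpa using (hx.tendsto_integral_abs (μ i)).const_mul M⁻¹
  obtain ⟨k, hk, y, hy0, hy1, hy⟩ :=
    exists_subseq_sum_le_one hmass g0 g1 (div_pos hε hM0) hlarge hlim
  -- The integral against the variation measure is the supremum of `f (k n)` over an order interval.
  -- Halving `ε / M / 4` leaves room to nearly attain it.
  have hz : ∀ n, ∃ z : C(Ω, ℝ), (∀ ω, |z ω| ≤ y n ω) ∧ ε / M / 8 ≤ f (k n) z := fun n => by
    have h1 : ε / M / 8 < ∫ ω, y n ω ∂μ (k n) := lt_of_lt_of_le (by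
      have : 0 < ε / M := by positivity
      linarith) (hy n)
    obtain ⟨_, ⟨z, hz, rfl⟩, hlt⟩ := (lt_isLUB_iff (hμ (k n) (y n) (hy0 n))).1 h1
    exact ⟨z, hz, hlt.le⟩
  choose z hzy hzf using hz
  exact ⟨ε / M / 8, by positivity, k, hk, z,
    fun n ω => (Finset.sum_le_sum fun j _ => hzy j ω).trans (hy1 n ω), hzf⟩

/-- Spaces of continuous functions have the Dunford-Pettis property. -/
theorem IsWeaklyNull.isDunfordPettisSet_range {x : ℕ → C(Ω, ℝ)} (hx : IsWeaklyNull x) :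
    IsDunfordPettisSet (Set.range x) := by
  refine DPLSets.isDunfordPettisSet_range hx fun φ hφ y hy _ => ?_
  refine Metric.tendsto_nhds.2 fun ε hε => ?_
  by_contra hcon
  obtain ⟨k, hk, hk'⟩ := extraction_of_frequently_atTop (not_eventually.1 hcon)
  obtain ⟨C, hC⟩ := hφ.exists_norm_le
  obtain ⟨δ, hδ, l, hl, z, hz, hlz⟩ := exists_sum_abs_le_one_of_le_apply
    (f := φ ∘ k) (fun n => hC (k n)) (hy.comp hk.tendsto_atTop) hε
    fun n => by simpa using hk' n
  have hDP := isDunfordPettisSet_range_of_sum_le zero_le_one (sum_norm_apply_le_of_sum_abs_le_one hz)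
  obtain ⟨n, hn⟩ := (Metric.tendstoUniformlyOn_iff.1
    (hDP.2 _ (hφ.comp (hk.comp hl).tendsto_atTop)) δ hδ).exists
  have h1 := hn (z n) ⟨n, rfl⟩
  rw [dist_zero_left] at h1
  exact absurd ((hlz n).trans (le_abs_self _)) (not_le.2 h1)

/-- If `‖T n‖ > 4 ^ n`, unit-ball vectors nearly attaining these norms, scaled by `2 ^ (-n)`, are
absolutely summable and hence `1`-Right null, yet their images are unbounded. -/
theorem IsDPL.exists_norm_le {X Y : Type*} [NormedAddCommGroup X] [NormedSpace ℝ X]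
    [NormedAddCommGroup Y] [NormedSpace ℝ Y] {K : Set (X →L[ℝ] Y)} (hK : IsDPL 1 K) :
    ∃ C, ∀ T ∈ K, ‖T‖ ≤ C := by
  by_contra! hcon
  choose T hTK hT using fun n : ℕ => hcon (4 ^ n)
  choose v hv hvT using fun n => (T n).exists_lt_apply_of_lt_opNorm (hT n)
  let x : ℕ → X := fun n => ((1 / 2 : ℝ) ^ n) • v n
  have hsum : ∀ φ : StrongDual ℝ X, ∀ s : Finset ℕ, ∑ n ∈ s, ‖φ (x n)‖ ≤ 2 * ‖φ‖ := by
    intro φ s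
    calc ∑ n ∈ s, ‖φ (x n)‖ ≤ ∑ n ∈ s, (1 / 2 : ℝ) ^ n * ‖φ‖ := by
          refine Finset.sum_le_sum fun n _ => ?_
          rw [map_smul, norm_smul, norm_pow, Real.norm_of_nonneg (by norm_num : (0 : ℝ) ≤ 1 / 2)]
          refine mul_le_mul_of_nonneg_left ?_ (by positivity)
          exact (φ.le_opNorm_of_le (hv n).le).trans_eq (mul_one _)
      _ = (∑ n ∈ s, (1 / 2 : ℝ) ^ n) * ‖φ‖ := by rw [Finset.sum_mul]
      _ ≤ 2 * ‖φ‖ := by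
          refine mul_le_mul_of_nonneg_right ?_ (norm_nonneg _)
          exact (summable_geometric_two.sum_le_tsum s fun _ _ => by positivity).trans_eq
            tsum_geometric_two
  have hev := isDPL_iff.1 hK x ⟨isWeaklySummable_one_of_sum_le hsum,
    isDunfordPettisSet_range_of_sum_le zero_le_two hsum⟩ (1 / 2) one_half_pos
  obtain ⟨n, hn⟩ := hev.exists
  have h1 := hn (T n) (hTK n)
  rw [map_smul, norm_smul, norm_pow, Real.norm_of_nonneg (by norm_num : (0 : ℝ) ≤ 1 / 2)] at h1
  have h2 : (1 / 2 : ℝ) ^ n * 4 ^ n ≤ (1 / 2 : ℝ) ^ n * ‖T n (v n)‖ := by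
    gcongr; exact (hvT n).le
  rw [← mul_pow] at h2
  have h3 : (1 : ℝ) ≤ (1 / 2 * 4) ^ n := one_le_pow₀ (by norm_num)
  linarith

/-- A failure along any weakly null sequence is converted into a failure along a weakly
unconditionally Cauchy one, which the `1`-(DPL) property excludes. -/
theorem IsDPL.of_continuousMap {p q : ℝ≥0∞} (hp : 1 ≤ p) {K : Set (StrongDual ℝ C(Ω, ℝ))}
    (hK : IsDPL p K) : IsDPL q K := by
  have hK1 : IsDPL 1 K := hK.anti hp
  obtain ⟨C, hC⟩ := hK1.exists_norm_le
  rw [isDPL_iff]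
  intro x hx ε hε
  by_contra hcon
  obtain ⟨k, hk, hk'⟩ := extraction_of_frequently_atTop (not_eventually.1 hcon)
  push Not at hk'
  choose f hfK hfε using hk'
  obtain ⟨δ, hδ, l, hl, z, hz, hlz⟩ := exists_sum_abs_le_one_of_le_apply
    (fun n => hC _ (hfK n)) (hx.1.isWeaklyNull.comp hk.tendsto_atTop) hε fun n => (hfε n).le
  have hz' := sum_norm_apply_le_of_sum_abs_le_one hz
  obtain ⟨n, hn⟩ := (isDPL_iff.1 hK1 z ⟨isWeaklySummable_one_of_sum_le hz',
    isDunfordPettisSet_range_of_sum_le zero_le_one hz'⟩ (δ / 2) (half_pos hδ)).exists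
  have h1 := hn _ (hfK (l n))
  have h2 := (hlz n).trans (le_abs_self _)
  rw [Real.norm_eq_abs] at h1
  linarith

end ContinuousFunctions

/-! ### Weakly summable sequences in `ℓ^r` -/

section SequenceSpace

theorem _root_.Memℓp.comp_injective {α β : Type*} {p : ℝ≥0∞} (h0 : p ≠ 0) (hp : p ≠ ∞) {a : α → ℝ}
    (h : Memℓp a p) {k : β → α} (hk : Function.Injective k) : Memℓp (a ∘ k) p :=
  memℓp_gen ((h.summable (ENNReal.toReal_pos h0 hp)).comp_injective hk)

theorem memℓp_geometric {p : ℝ≥0∞} (hp : 1 ≤ p) : Memℓp (fun n : ℕ => (1 / 2 : ℝ) ^ n) p := by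
  have h : Memℓp (fun n : ℕ => (1 / 2 : ℝ) ^ n) 1 := memℓp_gen (by
    simpa using summable_geometric_two)
  exact h.of_exponent_ge hp

theorem IsWeaklySummable.comp_injective {X : Type*} [NormedAddCommGroup X] [NormedSpace ℝ X]
    {p : ℝ≥0∞} (h0 : p ≠ 0) (hp : p ≠ ∞) {x : ℕ → X} (hx : IsWeaklySummable p x) {k : ℕ → ℕ}
    (hk : Function.Injective k) : IsWeaklySummable p (x ∘ k) :=
  (isWeaklySummable_iff hp).2 fun φ =>
    ((isWeaklySummable_iff hp).1 hx φ).comp_injective h0 hp hk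

variable {r : ℝ≥0∞} [Fact (1 ≤ r)]

/-- The projection of `ℓ^r` onto a finite set of coordinates. -/
noncomputable def blockProj (r : ℝ≥0∞) [Fact (1 ≤ r)] (s : Finset ℕ) :
    lp (fun _ : ℕ => ℝ) r →L[ℝ] lp (fun _ : ℕ => ℝ) r :=
  ∑ i ∈ s, (lp.singleContinuousLinearMap ℝ (fun _ : ℕ => ℝ) r i).comp
    (lp.evalCLM ℝ (fun _ : ℕ => ℝ) r i)

theorem blockProj_apply (s : Finset ℕ) (x : lp (fun _ : ℕ => ℝ) r) :
    blockProj r s x = ∑ i ∈ s, lp.single r i (x i) := by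
  simp only [blockProj, sum_apply]
  rfl

theorem blockProj_apply_coe (s : Finset ℕ) (x : lp (fun _ : ℕ => ℝ) r) (i : ℕ) :
    blockProj r s x i = if i ∈ s then x i else 0 := by
  rw [blockProj_apply, lp.coeFn_sum, Finset.sum_apply]
  simp [Finset.sum_pi_single]

theorem blockProj_blockProj (s t : Finset ℕ) (x : lp (fun _ : ℕ => ℝ) r) :
    blockProj r s (blockProj r t x) = blockProj r (s ∩ t) x := by
  ext i
  simp only [blockProj_apply_coe, Finset.mem_inter]
  split_ifs <;> tauto

theorem norm_blockProj_rpow (hr : r ≠ ∞) (s : Finset ℕ) (x : lp (fun _ : ℕ => ℝ) r) :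
    ‖blockProj r s x‖ ^ r.toReal = ∑ i ∈ s, ‖x i‖ ^ r.toReal := by
  rw [blockProj_apply]
  exact lp.norm_sum_single
    (ENNReal.toReal_pos (zero_lt_one.trans_le Fact.out).ne' hr) (fun i => x i) s

theorem blockProj_Ico (x : lp (fun _ : ℕ => ℝ) r) {N M : ℕ} (h : N ≤ M) :
    blockProj r (Finset.Ico N M) x =
      blockProj r (Finset.range M) x - blockProj r (Finset.range N) x := by
  simp only [blockProj_apply]
  exact Finset.sum_Ico_eq_sub (fun i => lp.single r i (x i)) h

theorem tendsto_blockProj_range (hr : r ≠ ∞) (x : lp (fun _ : ℕ => ℝ) r) :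
    Tendsto (fun N => blockProj r (Finset.range N) x) atTop (𝓝 x) := by
  simp only [blockProj_apply]
  exact (lp.hasSum_single hr x).tendsto_sum_nat

theorem tendsto_blockProj_of_isWeaklyNull {y : ℕ → lp (fun _ : ℕ => ℝ) r} (hy : IsWeaklyNull y)
    (s : Finset ℕ) : Tendsto (fun k => blockProj r s (y k)) atTop (𝓝 0) := by
  simp only [blockProj, sum_apply]
  have h : ∀ i ∈ s, Tendsto (fun k => (lp.singleContinuousLinearMap ℝ (fun _ : ℕ => ℝ) r i).comp
      (lp.evalCLM ℝ (fun _ : ℕ => ℝ) r i) (y k)) atTop (𝓝 0) := fun i _ => by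
    have h1 := (lp.singleContinuousLinearMap ℝ (fun _ : ℕ => ℝ) r i).continuous.tendsto 0
    rw [map_zero] at h1
    exact h1.comp (hy (lp.evalCLM ℝ (fun _ : ℕ => ℝ) r i))
  simpa using tendsto_finsetSum s h

theorem sum_norm_blockProj_rpow_le (hr : r ≠ ∞) {s : ℕ → Finset ℕ}
    (hs : Pairwise fun m n => Disjoint (s m) (s n)) (S : Finset ℕ) (x : lp (fun _ : ℕ => ℝ) r) :
    ∑ m ∈ S, ‖blockProj r (s m) x‖ ^ r.toReal ≤ ‖x‖ ^ r.toReal := by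
  simp only [norm_blockProj_rpow hr]
  rw [← Finset.sum_biUnion fun m _ n _ hmn => hs hmn]
  exact lp.sum_rpow_le_norm_rpow
    (ENNReal.toReal_pos (zero_lt_one.trans_le Fact.out).ne' hr) x _

theorem sum_mul_norm_blockProj_le (hr : r ≠ ∞) {q : ℝ} (hqr : q.HolderConjugate r.toReal)
    {s : ℕ → Finset ℕ} (hs : Pairwise fun m n => Disjoint (s m) (s n)) {a : ℕ → ℝ}
    (ha0 : ∀ n, 0 ≤ a n) (ha : Summable fun n => a n ^ q) (S : Finset ℕ)
    (x : lp (fun _ : ℕ => ℝ) r) :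
    ∑ m ∈ S, a m * ‖blockProj r (s m) x‖ ≤ (∑' n, a n ^ q) ^ (1 / q) * ‖x‖ := by
  refine (Real.inner_le_Lp_mul_Lq_of_nonneg S hqr (fun m _ => ha0 m)
    fun m _ => norm_nonneg _).trans ?_
  have hq := hqr.pos
  have hr0 := hqr.symm.pos
  gcongr
  · exact Real.rpow_nonneg (tsum_nonneg fun m => Real.rpow_nonneg (ha0 m) _) _
  · exact Finset.sum_nonneg fun m _ => Real.rpow_nonneg (ha0 m) _
  · exact ha.sum_le_tsum S fun m _ => Real.rpow_nonneg (ha0 m) _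
  · calc _ ≤ (‖x‖ ^ r.toReal) ^ (1 / r.toReal) := by
          gcongr
          exact sum_norm_blockProj_rpow_le hr hs S x
      _ = ‖x‖ := by
          rw [← Real.rpow_mul (norm_nonneg _), mul_one_div_cancel hr0.ne', Real.rpow_one]

theorem isWeaklySummable_single {q : ℝ≥0∞} (hq : q ≠ ∞)
    (hqr : q.toReal.HolderConjugate r.toReal) :
    IsWeaklySummable q fun n => (lp.single r n (1 : ℝ) : lp (fun _ : ℕ => ℝ) r) := by
  rw [isWeaklySummable_iff hq]
  intro φ
  refine memℓp_gen' (C := ‖φ‖ ^ q.toReal) fun s => ?_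
  set t : ℕ → ℝ := fun n => φ (lp.single r n (1 : ℝ))
  have hq0 := hqr.pos
  have hr0 := hqr.symm.pos
  have hr1 := hqr.symm.sub_one_pos
  have hq1 := hqr.sub_one_pos
  -- The extremal vector in Hölder's inequality: pairing it with `t` gives the `q`-th power sum of
  -- `t`, which is also its own `r`-th power sum.
  let a : ℕ → ℝ := fun n => (SignType.sign (t n) : ℝ) * |t n| ^ (q.toReal - 1)
  have hat : ∀ n, a n * t n = ‖t n‖ ^ q.toReal := fun n => by
    simp only [a, Real.norm_eq_abs]
    rw [mul_right_comm, sign_mul_self]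
    rcases eq_or_ne (t n) 0 with h | h
    · simp [h, Real.zero_rpow hq0.ne']
    · rw [Real.rpow_sub_one (abs_ne_zero.2 h), mul_div_cancel₀ _ (abs_ne_zero.2 h)]
  have hna : ∀ n, ‖a n‖ ^ r.toReal = ‖t n‖ ^ q.toReal := fun n => by
    rcases eq_or_ne (t n) 0 with h | h
    · simp [a, h, Real.zero_rpow hq0.ne', Real.zero_rpow hr0.ne']
    · have h1 : ‖a n‖ = |t n| ^ (q.toReal - 1) := by
        simp only [a]
        rw [norm_mul, Real.norm_of_nonneg (by positivity : 0 ≤ |t n| ^ (q.toReal - 1))]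
        rcases lt_or_gt_of_ne h with h | h
        · simp [sign_neg h]
        · simp [sign_pos h]
      rw [h1, ← Real.rpow_mul (abs_nonneg _), hqr.sub_one_mul_conj, Real.norm_eq_abs]
  let x : lp (fun _ : ℕ => ℝ) r := ∑ n ∈ s, lp.single r n (a n)
  have hx : ‖x‖ ^ r.toReal = ∑ n ∈ s, ‖t n‖ ^ q.toReal := by
    rw [lp.norm_sum_single hr0 (fun n => a n) s]
    exact Finset.sum_congr rfl fun n _ => hna n
  have hφx : φ x = ∑ n ∈ s, ‖t n‖ ^ q.toReal := by
    rw [map_sum]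
    refine Finset.sum_congr rfl fun n _ => ?_
    rw [← hat n, ← smul_eq_mul, ← map_smul, ← lp.single_smul, smul_eq_mul, mul_one]
  change ∑ n ∈ s, ‖t n‖ ^ q.toReal ≤ _
  rw [← hx]
  rcases eq_or_ne ‖x‖ 0 with h0 | h0
  · rw [h0, Real.zero_rpow hr0.ne']; positivity
  have hpos : 0 < ‖x‖ := lt_of_le_of_ne (norm_nonneg _) h0.symm
  have h1 : ‖x‖ ^ (r.toReal - 1) ≤ ‖φ‖ := by
    rw [Real.rpow_sub_one h0, div_le_iff₀ hpos, hx, ← hφx]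
    exact (le_abs_self _).trans (φ.le_opNorm x)
  calc ‖x‖ ^ r.toReal = (‖x‖ ^ (r.toReal - 1)) ^ q.toReal := by
        rw [← Real.rpow_mul (norm_nonneg _), hqr.symm.sub_one_mul_conj]
    _ ≤ ‖φ‖ ^ q.toReal := by gcongr

/-- Gliding hump: a subsequence bounded away from zero is close to disjoint blocks. Weighting
functionals that norm these blocks by some `a` in `ℓ^q` but not in `ℓ^p` gives one functional on
`ℓ^r` whose values along the subsequence dominate a multiple of `a`, up to a geometric error. -/
theorem tendsto_of_isWeaklySummable_lp {p q : ℝ≥0∞} (hp : 1 ≤ p) (hpq : p < q) (hq : q ≠ ∞)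
    (hr : r ≠ ∞) (hqr : q.toReal.HolderConjugate r.toReal) {y : ℕ → lp (fun _ : ℕ => ℝ) r}
    (hy : IsWeaklySummable p y) : Tendsto y atTop (𝓝 0) := by
  have hpt : p ≠ ∞ := hpq.ne_top
  have hp0 : p ≠ 0 := (zero_lt_one.trans_le hp).ne'
  have hpr : 0 < p.toReal := ENNReal.toReal_pos hp0 hpt
  have hpqr : p.toReal < q.toReal := (ENNReal.toReal_lt_toReal hpt hq).2 hpq
  refine Metric.tendsto_nhds.2 fun ε hε => ?_
  by_contra hcon
  have hfreq := not_eventually.1 hcon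
  have hnull := hy.isWeaklyNull
  have step : ∀ N : ℕ, ∃ k M, N ≤ k ∧ k < M ∧ ε ≤ ‖y k‖ ∧
      ‖y k - blockProj r (Finset.Ico N M) (y k)‖ ≤ ε / 2 * (1 / 2) ^ N := by
    intro N
    have hpos : 0 < ε / 4 * (1 / 2) ^ N := by positivity
    have h1 := (tendsto_blockProj_of_isWeaklyNull hnull (Finset.range N)).norm
    rw [norm_zero] at h1
    obtain ⟨k, hk, hk1, hkN⟩ := (hfreq.and_eventually
      ((h1.eventually_le_const hpos).and (eventually_ge_atTop N))).exists
    have h2 := (tendsto_blockProj_range hr (y k)).const_sub (y k) |>.norm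
    rw [sub_self, norm_zero] at h2
    obtain ⟨M, hM, hMk⟩ := ((h2.eventually_le_const hpos).and (eventually_gt_atTop k)).exists
    refine ⟨k, M, hkN, hMk, by simpa using hk, ?_⟩
    rw [blockProj_Ico _ (hkN.trans hMk.le), ← sub_add]
    exact (norm_add_le _ _).trans (by linarith)
  choose K M hNK hKM hε' hblock using step
  let N : ℕ → ℕ := fun m => Nat.rec 0 (fun _ n => M n) m
  have hN : ∀ m, N (m + 1) = M (N m) := fun m => rfl
  have hNmono : StrictMono N := strictMono_nat_of_lt_succ fun m => by
    rw [hN]; exact (hNK (N m)).trans_lt (hKM (N m))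
  let k : ℕ → ℕ := fun m => K (N m)
  have hk : StrictMono k := strictMono_nat_of_lt_succ fun m =>
    (hKM (N m)).trans_le (hNK (N (m + 1)))
  let s : ℕ → Finset ℕ := fun m => Finset.Ico (N m) (N (m + 1))
  have hs : Pairwise fun m n => Disjoint (s m) (s n) := by
    have : ∀ m n, m < n → Disjoint (s m) (s n) := fun m n hmn =>
      Finset.Ico_disjoint_Ico_consecutive _ _ _ |>.mono_right
        (Finset.Ico_subset_Ico (hNmono.monotone hmn) le_rfl)
    intro m n hmn
    rcases lt_or_gt_of_ne hmn with h | h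
    · exact this m n h
    · exact (this n m h).symm
  have hys : ∀ m, ‖y (k m) - blockProj r (s m) (y (k m))‖ ≤ ε / 2 * (1 / 2) ^ m := fun m =>
    (hblock (N m)).trans (mul_le_mul_of_nonneg_left
      (pow_le_pow_of_le_one (by norm_num) (by norm_num) (hNmono.id_le m)) (by positivity))
  -- The `p`-th powers form the harmonic series, while the `q`-th powers are summable because `q / p
  -- > 1`.
  let a : ℕ → ℝ := fun m => (1 / ((m : ℝ) + 1)) ^ (1 / p.toReal)
  have ha0 : ∀ m, 0 ≤ a m := fun m => by positivity
  have haq : Summable fun m => a m ^ q.toReal := by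
    have h1 : Summable fun m : ℕ => 1 / |(m : ℝ) + 1| ^ (q.toReal / p.toReal) :=
      (Real.summable_one_div_nat_add_rpow 1 _).2 ((one_lt_div hpr).2 hpqr)
    refine h1.congr fun m => ?_
    simp only [a]
    rw [← Real.rpow_mul (by positivity), abs_of_nonneg (by positivity),
      Real.div_rpow zero_le_one (by positivity), Real.one_rpow]
    congr 2
    ring
  choose g hg hgy using fun m => exists_dual_vector'' ℝ (blockProj r (s m) (y (k m)))
  let A : ℕ → (lp (fun _ : ℕ => ℝ) r →L[ℝ] ℝ) := fun m => a m • (g m).comp (blockProj r (s m))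
  have hAapp : ∀ m x, A m x = a m * g m (blockProj r (s m) x) := fun m x => rfl
  have hA : ∀ x, ∀ S : Finset ℕ,
      ∑ m ∈ S, ‖A m x‖ ≤ (∑' n, a n ^ q.toReal) ^ (1 / q.toReal) * ‖x‖ := fun x S => by
    refine (Finset.sum_le_sum fun m _ => ?_).trans (sum_mul_norm_blockProj_le hr hqr hs ha0 haq S x)
    rw [hAapp, norm_mul, Real.norm_of_nonneg (ha0 m)]
    exact mul_le_mul_of_nonneg_left (abs_apply_le_norm (hg m) _) (ha0 m)
  let ψ : StrongDual ℝ (lp (fun _ : ℕ => ℝ) r) :=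
    sumFunctional A _ hA (fun _ => ContinuousLinearMap.id ℝ ℝ) fun _ =>
      ContinuousLinearMap.norm_id_le
  have hψblock : ∀ m, ψ (blockProj r (s m) (y (k m))) = a m * ‖blockProj r (s m) (y (k m))‖ := by
    intro m
    have h1 : ψ (blockProj r (s m) (y (k m))) = ∑' n, A n (blockProj r (s m) (y (k m))) := rfl
    rw [h1, tsum_eq_single m fun n hn => ?_]
    · rw [hAapp, blockProj_blockProj, Finset.inter_self, hgy]
      rfl
    · rw [hAapp, blockProj_blockProj, Finset.disjoint_iff_inter_eq_empty.1 (hs hn)]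
      simp [blockProj_apply]
  have hbound : ∀ m, a m ≤ 2 / ε * |ψ (y (k m))| + ‖ψ‖ * (1 / 2) ^ m := by
    intro m
    have h1 : ψ (y (k m)) = a m * ‖blockProj r (s m) (y (k m))‖ +
        ψ (y (k m) - blockProj r (s m) (y (k m))) := by
      rw [map_sub, hψblock]; ring
    have h2 : |ψ (y (k m) - blockProj r (s m) (y (k m)))| ≤ ‖ψ‖ * (ε / 2 * (1 / 2) ^ m) :=
      ψ.le_opNorm_of_le (hys m)
    have h3 : ε / 2 ≤ ‖blockProj r (s m) (y (k m))‖ := by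
      have h4 : ‖y (k m)‖ ≤ ‖y (k m) - blockProj r (s m) (y (k m))‖ +
          ‖blockProj r (s m) (y (k m))‖ := by
        simpa using norm_add_le (y (k m) - blockProj r (s m) (y (k m)))
          (blockProj r (s m) (y (k m)))
      have h5 : ε / 2 * (1 / 2 : ℝ) ^ m ≤ ε / 2 :=
        mul_le_of_le_one_right (by positivity) (pow_le_one₀ (by norm_num) (by norm_num))
      have h6 : ε ≤ ‖y (k m)‖ := hε' (N m)
      linarith [hys m]
    have h7 : a m * (ε / 2) ≤ |ψ (y (k m))| + ‖ψ‖ * (ε / 2 * (1 / 2) ^ m) := by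
      have h8 : a m * (ε / 2) ≤ a m * ‖blockProj r (s m) (y (k m))‖ :=
        mul_le_mul_of_nonneg_left h3 (ha0 m)
      have h9 := (abs_le.1 h2).1
      linarith [le_abs_self (ψ (y (k m)))]
    have h10 : a m = 2 / ε * (a m * (ε / 2)) := by field_simp
    rw [h10]
    refine (mul_le_mul_of_nonneg_left h7 (by positivity)).trans_eq ?_
    field_simp
  have hmem : Memℓp (fun m => 2 / ε * |ψ (y (k m))| + ‖ψ‖ * (1 / 2) ^ m) p := by
    have h1 : Memℓp (fun m => ψ (y (k m))) p :=
      ((isWeaklySummable_iff hpt).1 hy ψ).comp_injective hp0 hpt hk.injective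
    exact (h1.norm.const_mul (2 / ε)).add ((memℓp_geometric hp).const_mul ‖ψ‖)
  have hap : Memℓp a p := hmem.mono fun m => by
    rw [Real.norm_of_nonneg (ha0 m)]; exact hbound m
  have hsum := hap.summable hpr
  refine Real.not_summable_one_div_natCast ((summable_nat_add_iff 1).1 (hsum.congr fun m => ?_))
  rw [Real.norm_of_nonneg (ha0 m)]
  simp only [a]
  rw [← Real.rpow_mul (by positivity), one_div_mul_cancel hpr.ne', Real.rpow_one]
  push_cast
  rfl

end SequenceSpace

/-! ### Ultralimits of adjoints -/

section Ultralimit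

variable {X Z : Type*} [NormedAddCommGroup X] [NormedSpace ℝ X]
  [NormedAddCommGroup Z] [NormedSpace ℝ Z]

theorem exists_tendsto_hyperfilter {a : ℕ → ℝ} {C : ℝ} (ha : ∀ n, |a n| ≤ C) :
    ∃ l, Tendsto a (hyperfilter ℕ) (𝓝 l) := by
  obtain ⟨l, -, hl⟩ := (isCompact_Icc (a := -C) (b := C)).ultrafilter_le_nhds
    ((hyperfilter ℕ).map a) (tendsto_principal.2 (Eventually.of_forall fun n => abs_le.1 (ha n)))
  exact ⟨l, hl⟩

/-- The adjoints of a bounded sequence of operators have a limit along an ultrafilter. -/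
theorem exists_ultralimit_adjoint {R : ℕ → X →L[ℝ] Z} {C : ℝ} (hR : ∀ n x, ‖R n x‖ ≤ C * ‖x‖) :
    ∃ Φ : StrongDual ℝ Z →L[ℝ] StrongDual ℝ X, ∀ φ x,
      Tendsto (fun n => φ (R n x)) (hyperfilter ℕ) (𝓝 (Φ φ x)) := by
  have hb : ∀ (φ : StrongDual ℝ Z) x n, |φ (R n x)| ≤ C * ‖φ‖ * ‖x‖ := fun φ x n => by
    refine (φ.le_opNorm_of_le (hR n x)).trans_eq (by ring)
  choose L hL using fun (φ : StrongDual ℝ Z) x => exists_tendsto_hyperfilter (hb φ x)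
  let B : StrongDual ℝ Z →ₗ[ℝ] X →ₗ[ℝ] ℝ := LinearMap.mk₂ ℝ L
    (fun φ ψ x => tendsto_nhds_unique (hL (φ + ψ) x) ((hL φ x).add (hL ψ x)))
    (fun c φ x => tendsto_nhds_unique (hL (c • φ) x) ((hL φ x).const_smul c))
    (fun φ x y => tendsto_nhds_unique (hL φ (x + y)) (by
      simpa only [map_add] using (hL φ x).add (hL φ y)))
    (fun c φ x => tendsto_nhds_unique (hL φ (c • x)) (by
      simpa only [map_smul] using (hL φ x).const_smul c))
  exact ⟨B.mkContinuous₂ C fun φ x => le_of_tendsto (hL φ x).norm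
    (Eventually.of_forall fun n => hb φ x n), hL⟩

end Ultralimit

/-! ### Gluing an `ℓ¹`-sum to a Banach space -/

section Gluing

variable {E : Type*} [NormedAddCommGroup E] [NormedSpace ℝ E]
  {B : ℕ → Type*} [∀ j, NormedAddCommGroup (B j)] [∀ j, NormedSpace ℝ (B j)]
  (T : ∀ j, E →L[ℝ] B j) (G : ℕ → Submodule ℝ E)

theorem hasSum_norm_lp_one (c : lp B 1) : HasSum (fun j => ‖c j‖) ‖c‖ := by
  simpa using lp.hasSum_norm (p := 1) (by simp) c

/-- The embedding of `E` into `E × ℓ¹(B)` whose values on `G j` are collapsed in the gluing. -/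
noncomputable def gluingMap (j : ℕ) : E →L[ℝ] E × lp B 1 :=
  (-ContinuousLinearMap.id ℝ E).prod ((lp.singleContinuousLinearMap ℝ B 1 j).comp (T j))

theorem gluingMap_apply (j : ℕ) (x : E) : gluingMap T j x = (-x, lp.single 1 j (T j x)) := rfl

/-- The subspace of `E × ℓ¹(B)` spanned by the relations `x = T j x` for `x ∈ G j`. -/
noncomputable def gluingSubmodule : Submodule ℝ (E × lp B 1) :=
  (⨆ j, (G j).map (gluingMap T j : E →ₗ[ℝ] E × lp B 1)).topologicalClosure

instance isClosed_gluingSubmodule : IsClosed (gluingSubmodule T G : Set (E × lp B 1)) :=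
  Submodule.isClosed_topologicalClosure _

/-- The pushout of `E` and the `ℓ¹`-sum of the spaces `B j` along the maps `T j : G j → B j`. -/
abbrev Gluing : Type _ := (E × lp B 1) ⧸ gluingSubmodule T G

variable {T G}

theorem gluingMap_mem {j : ℕ} {x : E} (hx : x ∈ G j) : gluingMap T j x ∈ gluingSubmodule T G :=
  Submodule.le_topologicalClosure _ (Submodule.mem_iSup_of_mem j ⟨x, hx, rfl⟩)

/-- For finite sums of relations, the triangle inequality on the first coordinate meets additivity
of the `ℓ¹` norm on the second; the estimate is closed. It is what keeps `E` isomorphically embedded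
after the quotient. -/
theorem norm_fst_le_of_mem_gluingSubmodule (hT : ∀ j, ∀ x ∈ G j, ‖x‖ ≤ 2 * ‖T j x‖)
    {v : E × lp B 1} (hv : v ∈ gluingSubmodule T G) : ‖v.1‖ ≤ 2 * ‖v.2‖ := by
  have hclosed : IsClosed {v : E × lp B 1 | ‖v.1‖ ≤ 2 * ‖v.2‖} :=
    isClosed_le (by fun_prop) (by fun_prop)
  refine closure_minimal (fun w hw => ?_) hclosed hv
  obtain ⟨f, hf, rfl⟩ := (Submodule.mem_iSup_iff_exists_finsupp _ w).1 hw
  choose x hxG hx using hf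
  have hw1 : (f.sum fun _ y => y).1 = ∑ j ∈ f.support, -x j := by
    rw [Finsupp.sum, Prod.fst_sum]
    exact Finset.sum_congr rfl fun j _ => by rw [← hx j]; rfl
  have hw2 : (f.sum fun _ y => y).2 = ∑ j ∈ f.support, lp.single 1 j (T j (x j)) := by
    rw [Finsupp.sum, Prod.snd_sum]
    exact Finset.sum_congr rfl fun j _ => by rw [← hx j]; rfl
  have hnorm : ‖∑ j ∈ f.support, lp.single 1 j (T j (x j))‖ = ∑ j ∈ f.support, ‖T j (x j)‖ := by
    simpa using lp.norm_sum_single (p := 1) (by simp) (fun j => T j (x j)) f.support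
  rw [Set.mem_ofPred_eq, hw1, hw2, hnorm, Finset.mul_sum]
  refine (norm_sum_le _ _).trans (Finset.sum_le_sum fun j _ => ?_)
  rw [norm_neg]
  exact hT j _ (hxG j)

theorem neg_tsum_mem_gluingSubmodule {c : lp B 1} {x : ℕ → E} {a : E} (hx : ∀ j, x j ∈ G j)
    (hc : ∀ j, T j (x j) = c j) (ha : HasSum x a) : (-a, c) ∈ gluingSubmodule T G := by
  have h : HasSum (fun j => gluingMap T j (x j)) (-a, c) := by
    have h1 := lp.hasSum_single ENNReal.one_ne_top c
    refine (ha.neg.prodMk h1).congr_fun fun j => ?_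
    rw [gluingMap_apply, hc]
  exact (isClosed_gluingSubmodule T G).mem_of_tendsto h (Eventually.of_forall fun s =>
    Submodule.sum_mem _ fun j _ => gluingMap_mem (hx j))

variable (T G)

/-- The canonical map from `E` to the gluing. -/
noncomputable def gluingInl : E →L[ℝ] Gluing T G :=
  (gluingSubmodule T G).mkQL.comp (ContinuousLinearMap.inl ℝ E (lp B 1))

/-- The canonical map from `B j` to the gluing. -/
noncomputable def gluingInr (j : ℕ) : B j →L[ℝ] Gluing T G :=
  (gluingSubmodule T G).mkQL.comp ((ContinuousLinearMap.inr ℝ E (lp B 1)).comp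
    (lp.singleContinuousLinearMap ℝ B 1 j))

variable {T G}

theorem norm_gluingInr_le (j : ℕ) (b : B j) : ‖gluingInr T G j b‖ ≤ ‖b‖ := by
  refine (Submodule.Quotient.norm_mk_le (gluingSubmodule T G) _).trans ?_
  change ‖((0 : E), (lp.single 1 j b : lp B 1))‖ ≤ ‖b‖
  rw [Prod.norm_mk, norm_zero, lp.norm_single zero_lt_one]
  exact max_le (norm_nonneg _) le_rfl

theorem gluingInr_apply_eq {j : ℕ} {x : E} (hx : x ∈ G j) :
    gluingInr T G j (T j x) = gluingInl T G x := by
  refine (Submodule.Quotient.eq (gluingSubmodule T G)).2 ?_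
  have h := gluingMap_mem (T := T) hx
  rw [gluingMap_apply] at h
  convert h using 1
  simp

theorem norm_le_gluingInl (hT : ∀ j, ∀ x ∈ G j, ‖x‖ ≤ 2 * ‖T j x‖) (x : E) :
    ‖x‖ ≤ 3 * ‖gluingInl T G x‖ := by
  refine le_of_forall_pos_le_add fun ε hε => ?_
  obtain ⟨v, hv, hvn⟩ := Submodule.Quotient.norm_mk_lt (gluingInl T G x)
    (by positivity : 0 < ε / 3)
  have hmem : v - (x, 0) ∈ gluingSubmodule T G := (Submodule.Quotient.eq _).1 hv
  have h1 := norm_fst_le_of_mem_gluingSubmodule hT hmem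
  simp only [Prod.fst_sub, Prod.snd_sub, sub_zero] at h1
  have h2 : ‖x‖ ≤ ‖v.1 - x‖ + ‖v.1‖ := by
    rw [norm_sub_rev]; simpa using norm_add_le (x - v.1) v.1
  have h3 := norm_fst_le v
  have h4 := norm_snd_le v
  linarith

variable {D : ℕ → Type*} [∀ j, NormedAddCommGroup (D j)] [∀ j, NormedSpace ℝ (D j)]
  (π : ∀ j, B j →L[ℝ] D j)

/-- The map on the gluing induced by a map on `B j` which vanishes on the glued subspace. -/
noncomputable def gluingComponent (hπ : ∀ j, ∀ x ∈ G j, π j (T j x) = 0) (j : ℕ) :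
    Gluing T G →L[ℝ] D j :=
  (gluingSubmodule T G).liftQL
    (((π j).comp (lp.evalCLM ℝ B 1 j)).comp (ContinuousLinearMap.snd ℝ E (lp B 1))) (by
    refine Submodule.topologicalClosure_minimal _ (iSup_le fun i => ?_)
      (ContinuousLinearMap.isClosed_ker _)
    rintro _ ⟨x, hx, rfl⟩
    change π j ((lp.single 1 i (T i x) : lp B 1) j) = 0
    rcases eq_or_ne j i with rfl | hne
    · rw [lp.single_apply_self]
      exact hπ j x hx
    · rw [lp.single_apply_ne _ _ _ hne, map_zero])

variable {π}

theorem sum_norm_gluingComponent_le (hπ : ∀ j, ∀ x ∈ G j, π j (T j x) = 0)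
    (hπ1 : ∀ j b, ‖π j b‖ ≤ ‖b‖) (z : Gluing T G) (s : Finset ℕ) :
    ∑ j ∈ s, ‖gluingComponent π hπ j z‖ ≤ 1 * ‖z‖ := by
  rw [one_mul]
  refine le_of_forall_pos_le_add fun ε hε => ?_
  obtain ⟨v, rfl, hvn⟩ := Submodule.Quotient.norm_mk_lt z hε
  refine le_trans ?_ hvn.le
  calc ∑ j ∈ s, ‖gluingComponent π hπ j (Submodule.Quotient.mk v)‖ ≤ ∑ j ∈ s, ‖v.2 j‖ :=
        Finset.sum_le_sum fun j _ => hπ1 j _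
    _ ≤ ‖v.2‖ := sum_le_hasSum s (fun _ _ => norm_nonneg _) (hasSum_norm_lp_one v.2)
    _ ≤ ‖v‖ := norm_snd_le v

variable [CompleteSpace E]

/-- Modulo `E`, the gluing is the `ℓ¹`-sum of the quotients of `B j` by `T j (G j)`. Correct each
coordinate by a nearly optimal `T j (x j)`; the lower bound on `T j` makes `x` summable, so the
corrections together amount to an element of `E`. -/
theorem exists_norm_sub_gluingInl_le (hT : ∀ j, ∀ x ∈ G j, ‖x‖ ≤ 2 * ‖T j x‖)
    (hπ : ∀ j, ∀ x ∈ G j, π j (T j x) = 0) (hπ1 : ∀ j b, ‖π j b‖ ≤ ‖b‖)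
    (hπ2 : ∀ j b ε, 0 < ε → ∃ x ∈ G j, ‖b - T j x‖ ≤ ‖π j b‖ + ε)
    (z : Gluing T G) {ε : ℝ} (hε : 0 < ε) :
    ∃ x : E, ‖z - gluingInl T G x‖ ≤ ∑' j, ‖gluingComponent π hπ j z‖ + ε := by
  obtain ⟨v, rfl⟩ := Submodule.Quotient.mk_surjective _ z
  have hsum : Summable fun j => ‖π j (v.2 j)‖ :=
    .of_nonneg_of_le (fun _ => norm_nonneg _) (fun j => hπ1 j _) (hasSum_norm_lp_one v.2).summable
  obtain ⟨η, hη0, t, hηt, htε⟩ : ∃ η : ℕ → ℝ, (∀ i, 0 < η i) ∧ ∃ c, HasSum η c ∧ c ≤ ε :=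
    ⟨_, (posSumOfEncodable hε ℕ).2⟩
  choose x hxG hx using fun j => hπ2 j (v.2 j) (η j) (hη0 j)
  have hdsum : Summable fun j => ‖v.2 j - T j (x j)‖ := .of_nonneg_of_le (fun _ => norm_nonneg _)
    hx (hsum.add hηt.summable)
  let d : lp B 1 := ⟨fun j => v.2 j - T j (x j), memℓp_gen (by simpa using hdsum)⟩
  have hd : ‖d‖ ≤ ∑' j, ‖π j (v.2 j)‖ + ε :=
    (hasSum_le hx (hasSum_norm_lp_one d) (hsum.hasSum.add hηt)).trans (by linarith)
  have hc : ∀ j, T j (x j) = (v.2 - d) j := fun j => by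
    change _ = v.2 j - (v.2 j - T j (x j))
    rw [sub_sub_cancel]
  have hxsum : Summable x := by
    refine .of_norm_bounded (g := fun j => 2 * ‖(v.2 - d) j‖)
      ((hasSum_norm_lp_one (v.2 - d)).summable.mul_left 2) fun j => ?_
    rw [← hc]
    exact hT j _ (hxG j)
  have hN := neg_tsum_mem_gluingSubmodule hxG hc hxsum.hasSum
  refine ⟨v.1 + ∑' j, x j, le_trans ?_ hd⟩
  have heq : (Submodule.Quotient.mk v : Gluing T G) - gluingInl T G (v.1 + ∑' j, x j) =
      Submodule.Quotient.mk ((0 : E), d) := by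
    change Submodule.Quotient.mk (v - (v.1 + ∑' j, x j, 0)) = _
    rw [Submodule.Quotient.eq]
    convert hN using 1
    ext1 <;> simp
  rw [heq]
  refine (Submodule.Quotient.norm_mk_le _ _).trans ?_
  rw [Prod.norm_mk, norm_zero]
  exact max_le (norm_nonneg _) le_rfl

theorem IsWeaklyNull.exists_tendsto_sub_gluingInl [∀ j, FiniteDimensional ℝ (D j)]
    (hT : ∀ j, ∀ x ∈ G j, ‖x‖ ≤ 2 * ‖T j x‖)
    (hπ : ∀ j, ∀ x ∈ G j, π j (T j x) = 0) (hπ1 : ∀ j b, ‖π j b‖ ≤ ‖b‖)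
    (hπ2 : ∀ j b ε, 0 < ε → ∃ x ∈ G j, ‖b - T j x‖ ≤ ‖π j b‖ + ε)
    {z : ℕ → Gluing T G} (hz : IsWeaklyNull z) :
    ∃ x : ℕ → E, Tendsto (fun n => z n - gluingInl T G (x n)) atTop (𝓝 0) := by
  have hlim := hz.tendsto_tsum_norm (sum_norm_gluingComponent_le hπ hπ1)
  choose x hx using fun n : ℕ => exists_norm_sub_gluingInl_le hT hπ hπ1 hπ2 (z n)
    (Nat.one_div_pos_of_nat (n := n) : (0 : ℝ) < 1 / (n + 1))
  refine ⟨x, squeeze_zero_norm hx ?_⟩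
  simpa using hlim.add tendsto_one_div_add_atTop_nhds_zero_nat

end Gluing

/-! ### The enlarged space -/

section Embedding

variable {E : Type*} [NormedAddCommGroup E] [NormedSpace ℝ E]

/-- A finite-dimensional subspace is normed, up to a factor of two, by finitely many functionals. -/
theorem exists_finite_norming (G : Submodule ℝ E) [FiniteDimensional ℝ G] :
    ∃ (n : ℕ) (f : Fin n → StrongDual ℝ E), (∀ i, ‖f i‖ ≤ 1) ∧
      ∀ x ∈ G, ‖x‖ ≤ 2 * ‖fun i => f i x‖ := by
  have : ProperSpace G := FiniteDimensional.proper_real G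
  -- A functional norming a net point within `1 / 4` of a unit vector takes a value at least `3 / 4`
  -- there, so the factor two suffices.
  obtain ⟨t, ht, htf, hcov⟩ := Metric.finite_approx_of_totallyBounded
    (isCompact_sphere (0 : G) 1).totallyBounded (1 / 4) (by norm_num)
  choose g hg hgx using fun x : G => exists_dual_vector'' ℝ (x : E)
  have : Fintype t := htf.fintype
  let σ := (Fintype.equivFin t).symm
  refine ⟨Fintype.card t, fun i => g (σ i), fun i => hg _, fun x hx => ?_⟩
  rcases eq_or_ne x 0 with rfl | hx0
  · simp
  have hpos : 0 < ‖x‖ := norm_pos_iff.2 hx0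
  let u : G := ‖x‖⁻¹ • ⟨x, hx⟩
  have hu : u ∈ Metric.sphere (0 : G) 1 := by
    rw [mem_sphere_zero_iff_norm, norm_smul, norm_inv, norm_norm]
    exact inv_mul_cancel₀ hpos.ne'
  obtain ⟨y, hyt, hy⟩ := Set.mem_iUnion₂.1 (hcov hu)
  rw [Metric.mem_ball, dist_eq_norm] at hy
  have hy1 : ‖(y : E)‖ = 1 := mem_sphere_zero_iff_norm.1 (ht hyt)
  have h1 : |g y ((u : E) - y)| ≤ 1 / 4 :=
    (abs_apply_le_norm (hg y) _).trans hy.le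
  have h2 : g y (u : E) = 1 + g y ((u : E) - y) := by
    rw [map_sub, hgx, hy1]; simp
  have h3 : 1 / 2 ≤ |g y (u : E)| := by
    rw [h2]
    exact le_trans (by linarith [(abs_le.1 h1).1]) (le_abs_self _)
  have h4 : |g y (u : E)| = ‖x‖⁻¹ * |g y x| := by
    change |g y (‖x‖⁻¹ • x)| = _
    rw [map_smul, smul_eq_mul, abs_mul, abs_of_pos (inv_pos.2 hpos)]
  rw [h4, le_inv_mul_iff₀ hpos] at h3
  have h5 : |g y x| ≤ ‖fun i => g (σ i) x‖ := by
    have := norm_le_pi_norm (fun i => g (σ i) x) (σ.symm ⟨y, hyt⟩)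
    simpa using this
  linarith

/-- Every Banach space embeds into one in which a given weakly null sequence has Dunford-Pettis
range, with weakly null sequences in the larger space asymptotic to the smaller one. -/
theorem exists_embedding_isDunfordPettisSet {E : Type} [NormedAddCommGroup E] [NormedSpace ℝ E]
    [CompleteSpace E] {e : ℕ → E} (he : IsWeaklyNull e) :
    ∃ (Z : Type) (_ : NormedAddCommGroup Z) (_ : NormedSpace ℝ Z) (_ : CompleteSpace Z)
      (ι : E →L[ℝ] Z), (∀ x, ‖x‖ ≤ 3 * ‖ι x‖) ∧ IsDunfordPettisSet (Set.range fun n => ι (e n)) ∧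
      ∀ z : ℕ → Z, IsWeaklyNull z → ∃ x : ℕ → E, Tendsto (fun n => z n - ι (x n)) atTop (𝓝 0) := by
  let Ω : Set (WeakDual ℝ E) := WeakDual.toStrongDual ⁻¹' Metric.closedBall (0 : StrongDual ℝ E) 1
  have hΩ : CompactSpace Ω := isCompact_iff_compactSpace.1 (WeakDual.isCompact_closedBall _ _)
  have hΩn : ∀ ω : Ω, ‖WeakDual.toStrongDual ω.1‖ ≤ 1 := fun ω =>
    mem_closedBall_zero_iff.1 ω.2
  let J : E →L[ℝ] C(Ω, ℝ) := LinearMap.mkContinuous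
    { toFun := fun x => ⟨fun ω => ω.1 x, (WeakDual.eval_continuous x).comp continuous_subtype_val⟩
      map_add' := fun x y => by ext ω; exact map_add ω.1 x y
      map_smul' := fun c x => by ext ω; exact map_smul ω.1 c x } 1 fun x => by
    rw [one_mul]
    exact (ContinuousMap.norm_le _ (norm_nonneg x)).2 fun ω => abs_apply_le_norm (hΩn ω) x
  let G : ℕ → Submodule ℝ E := fun j => Submodule.span ℝ (e '' Set.Iic j)
  have hGfin : ∀ j, FiniteDimensional ℝ (G j) := fun j =>
    FiniteDimensional.span_of_finite ℝ ((Set.finite_Iic j).image e)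
  choose m f hf hfG using fun j => exists_finite_norming (G j)
  let ω : ∀ j, Fin (m j) → Ω := fun j i => ⟨StrongDual.toWeakDual (f j i), by
    simpa [Ω] using hf j i⟩
  let ρ : ∀ j, C(Ω, ℝ) →L[ℝ] (Fin (m j) → ℝ) := fun j =>
    ContinuousLinearMap.pi fun i => ContinuousMap.evalCLM ℝ (ω j i)
  have hρ : ∀ j h, ‖ρ j h‖ ≤ ‖h‖ := fun j h =>
    (pi_norm_le_iff_of_nonneg (norm_nonneg _)).2 fun i => h.norm_coe_le_norm (ω j i)
  let T : ∀ j, E →L[ℝ] (Fin (m j) → ℝ) := fun j => (ρ j).comp J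
  have hT : ∀ j, ∀ x ∈ G j, ‖x‖ ≤ 2 * ‖T j x‖ := hfG
  refine ⟨Gluing T G, inferInstance, inferInstance, inferInstance, gluingInl T G,
    norm_le_gluingInl hT, ?_, fun z hz => ?_⟩
  -- The maps from `C(Ω)` through the `j`-th glued piece send `J (e n)` to the image of `e n` as
  -- soon as `j ≥ n`. Hence `Φ`, a limit of their adjoints, turns values of `φ` on these images into
  -- values of `Φ φ` on `J (e n)`, and the Dunford–Pettis property of `C(Ω)` applies.
  · obtain ⟨Φ, hΦ⟩ := exists_ultralimit_adjoint (R := fun j => (gluingInr T G j).comp (ρ j)) (C := 1)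
      fun j h => by rw [one_mul]; exact (norm_gluingInr_le j _).trans (hρ j h)
    have hΦe : ∀ φ n, Φ φ (J (e n)) = φ (gluingInl T G (e n)) := fun φ n => by
      refine tendsto_nhds_unique (hΦ φ (J (e n))) (tendsto_nhds_of_eventually_eq ?_)
      have h1 : ∀ᶠ j in hyperfilter ℕ, n ≤ j := by
        have : (hyperfilter ℕ : Filter ℕ) ≤ atTop := Nat.cofinite_eq_atTop ▸ hyperfilter_le_cofinite
        exact this (eventually_ge_atTop n)
      filter_upwards [h1] with j hj
      have h2 : e n ∈ G j := Submodule.subset_span ⟨n, hj, rfl⟩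
      exact congrArg φ (gluingInr_apply_eq h2)
    have hDP := (he.map J).isDunfordPettisSet_range
    refine ⟨?_, fun φ hφ => ?_⟩
    · obtain ⟨C, hC⟩ := (he.map (gluingInl T G)).exists_norm_le
      exact isBounded_iff_forall_norm_le.2 ⟨C, by rintro _ ⟨n, rfl⟩; exact hC n⟩
    · have h1 := Metric.tendstoUniformlyOn_iff.1 (hDP.2 _ (hφ.map Φ))
      rw [Metric.tendstoUniformlyOn_iff]
      intro ε hε
      filter_upwards [h1 ε hε] with k hk
      rintro _ ⟨n, rfl⟩
      have h2 := hk _ ⟨n, rfl⟩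
      rwa [hΦe] at h2
  · let S : ∀ j, Submodule ℝ (Fin (m j) → ℝ) := fun j =>
      (G j).map (T j : E →ₗ[ℝ] (Fin (m j) → ℝ))
    have hclosed : ∀ j, IsClosed (S j : Set (Fin (m j) → ℝ)) := fun j =>
      Submodule.closed_of_finiteDimensional _
    refine hz.exists_tendsto_sub_gluingInl (D := fun j => (Fin (m j) → ℝ) ⧸ S j)
      (π := fun j => (S j).mkQL) hT (fun j x hx => ?_) (fun j b => ?_) fun j b ε hε => ?_
    · exact (Submodule.Quotient.mk_eq_zero _).2 ⟨x, hx, rfl⟩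
    · exact Submodule.Quotient.norm_mk_le _ _
    · obtain ⟨d, hd, hdn⟩ := Submodule.Quotient.norm_mk_lt ((S j).mkQL b) hε
      obtain ⟨x, hx, hxb⟩ := (Submodule.Quotient.eq (S j)).1 hd.symm
      refine ⟨x, hx, ?_⟩
      have : b - T j x = d := by
        rw [sub_eq_iff_eq_add', ← sub_eq_iff_eq_add]; exact hxb.symm
      rw [this]
      exact hdn.le

end Embedding

/-! ### Strictness in part (v) -/

section Counterexample

variable {E Z : Type*} [NormedAddCommGroup E] [NormedSpace ℝ E]
  [NormedAddCommGroup Z] [NormedSpace ℝ Z]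

theorem exists_extension_of_norm_le {ι : E →L[ℝ] Z} {C : ℝ} (hι : ∀ x, ‖x‖ ≤ C * ‖ι x‖)
    (φ : StrongDual ℝ E) : ∃ ψ : StrongDual ℝ Z, ∀ x, ψ (ι x) = φ x := by
  have hinj : Function.Injective (ι : E →ₗ[ℝ] Z) := by
    refine (injective_iff_map_eq_zero _).2 fun x hx => norm_le_zero_iff.1 ((hι x).trans ?_)
    have : ι x = 0 := hx
    simp [this]
  let e := LinearEquiv.ofInjective (ι : E →ₗ[ℝ] Z) hinj
  let f : StrongDual ℝ (LinearMap.range (ι : E →ₗ[ℝ] Z)) :=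
    LinearMap.mkContinuous ((φ : E →ₗ[ℝ] ℝ).comp (e.symm : _ →ₗ[ℝ] E)) (‖φ‖ * C) fun y => by
      obtain ⟨x, rfl⟩ := e.surjective y
      rw [LinearMap.comp_apply, LinearEquiv.coe_coe, e.symm_apply_apply, mul_assoc]
      exact φ.le_opNorm_of_le (hι x)
  obtain ⟨ψ, hψ, -⟩ := exists_extension_norm_eq _ f
  refine ⟨ψ, fun x => (hψ (e x)).trans ?_⟩
  change φ (e.symm (e x)) = φ x
  rw [e.symm_apply_apply]

theorem IsWeaklySummable.of_comp {p : ℝ≥0∞} (hp : p ≠ ∞) {ι : E →L[ℝ] Z} {C : ℝ}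
    (hι : ∀ x, ‖x‖ ≤ C * ‖ι x‖) {x : ℕ → E} (hx : IsWeaklySummable p fun n => ι (x n)) :
    IsWeaklySummable p x := by
  rw [isWeaklySummable_iff hp] at hx ⊢
  intro φ
  obtain ⟨ψ, hψ⟩ := exists_extension_of_norm_le hι φ
  simpa only [hψ] using hx ψ

theorem IsWeaklySummable.map {p : ℝ≥0∞} (hp : p ≠ ∞) {x : ℕ → E} (hx : IsWeaklySummable p x)
    (T : E →L[ℝ] Z) : IsWeaklySummable p fun n => T (x n) :=
  (isWeaklySummable_iff hp).2 fun φ => (isWeaklySummable_iff hp).1 hx (φ.comp T)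

theorem IsWeaklySummable.sub_of_norm_le_geometric {p : ℝ≥0∞} (hp1 : 1 ≤ p) (hp : p ≠ ∞)
    {x y : ℕ → Z} (hx : IsWeaklySummable p x) (hxy : ∀ n, ‖x n - y n‖ ≤ (1 / 2) ^ n) :
    IsWeaklySummable p y := by
  rw [isWeaklySummable_iff hp] at hx ⊢
  intro φ
  have h1 : Memℓp (fun n => φ (x n - y n)) p :=
    ((memℓp_geometric hp1).const_mul ‖φ‖).mono fun n => φ.le_opNorm_of_le (hxy n)
  have h2 : (fun n => φ (y n)) = (fun n => φ (x n)) - fun n => φ (x n - y n) := by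
    ext n; simp
  rw [h2]
  exact (hx φ).sub h1

/-- Along a subsequence the distance to `E` is at most `(1 / 2) ^ n`, and such a perturbation
preserves weak `p`-summability. Extending functionals from `E` carries this summability back to `E`,
where it forces norm convergence. -/
theorem tendsto_of_isWeaklySummable_of_asymptotic {p : ℝ≥0∞} (hp1 : 1 ≤ p) (hp : p ≠ ∞)
    {ι : E →L[ℝ] Z} {C : ℝ} (hι : ∀ x, ‖x‖ ≤ C * ‖ι x‖)
    (hE : ∀ y : ℕ → E, IsWeaklySummable p y → Tendsto y atTop (𝓝 0)) {z : ℕ → Z}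
    (hz : IsWeaklySummable p z) {x : ℕ → E} (hzx : Tendsto (fun n => z n - ι (x n)) atTop (𝓝 0)) :
    Tendsto z atTop (𝓝 0) := by
  refine tendsto_of_subseq_tendsto fun k hk => ?_
  obtain ⟨l, hl, hl'⟩ := strictMono_subseq_of_tendsto_atTop hk
  have h1 := (hzx.comp hl'.tendsto_atTop).norm
  rw [norm_zero] at h1
  obtain ⟨j, hj, hj'⟩ := extraction_forall_of_eventually
    (fun n : ℕ => h1.eventually_le_const (by positivity : (0 : ℝ) < (1 / 2) ^ n))
  have hinj : Function.Injective ((k ∘ l) ∘ j) := (hl'.comp hj).injective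
  have h2 : IsWeaklySummable p fun n => ι (x (k (l (j n)))) :=
    (hz.comp_injective (zero_lt_one.trans_le hp1).ne' hp hinj).sub_of_norm_le_geometric hp1 hp hj'
  have h3 := (ι.continuous.tendsto 0).comp (hE _ (h2.of_comp hp hι))
  rw [map_zero] at h3
  refine ⟨l ∘ j, ?_⟩
  have h4 := (hzx.comp (hl'.comp hj).tendsto_atTop).add h3
  rw [add_zero] at h4
  refine h4.congr fun n => ?_
  simp

theorem exists_isDPL_not_isDPL_of_ne_top {p q : ℝ≥0∞} (hp : 1 ≤ p) (hpq : p < q) (hq : q ≠ ∞) :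
    ∃ (Z : Type) (_ : NormedAddCommGroup Z) (_ : NormedSpace ℝ Z) (_ : CompleteSpace Z)
      (K : Set (StrongDual ℝ Z)), IsDPL p K ∧ ¬ IsDPL q K := by
  have hq1 : 1 < q.toReal := by
    rw [← ENNReal.toReal_one]
    exact (ENNReal.toReal_lt_toReal ENNReal.one_ne_top hq).2 (hp.trans_lt hpq)
  have hqr := Real.HolderConjugate.conjExponent hq1
  let r : ℝ≥0∞ := ENNReal.ofReal (Real.conjExponent q.toReal)
  have hrr : r.toReal = Real.conjExponent q.toReal := ENNReal.toReal_ofReal hqr.symm.nonneg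
  rw [← hrr] at hqr
  have : Fact (1 ≤ r) := ⟨by
    rw [← ENNReal.ofReal_one]
    exact ENNReal.ofReal_le_ofReal (hrr ▸ hqr.symm.lt.le)⟩
  have hr : r ≠ ∞ := ENNReal.ofReal_ne_top
  have he := isWeaklySummable_single hq hqr
  obtain ⟨Z, _, _, _, ι, hι, hDP, hlift⟩ := exists_embedding_isDunfordPettisSet he.isWeaklyNull
  refine ⟨Z, _, _, ‹_›, Metric.closedBall 0 1, ?_, fun hcon => ?_⟩
  · rw [isDPL_iff]
    intro z hz ε hε
    obtain ⟨x, hx⟩ := hlift z hz.1.isWeaklyNull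
    have h1 := (tendsto_of_isWeaklySummable_of_asymptotic hp hpq.ne_top hι
      (fun y hy => tendsto_of_isWeaklySummable_lp hp hpq hq hr hqr hy) hz.1 hx).norm
    rw [norm_zero] at h1
    filter_upwards [h1.eventually_le_const hε] with n hn T hT
    exact (abs_apply_le_norm (mem_closedBall_zero_iff.1 hT) _).trans hn
  -- The embedded unit vectors have norm at least `1 / 3`, so `1 / 4` is violated by a norming
  -- functional.
  · obtain ⟨n, hn⟩ := (isDPL_iff.1 hcon _ ⟨he.map hq ι, hDP⟩ (1 / 4) (by norm_num)).exists
    obtain ⟨g, hg, hgz⟩ := exists_dual_vector'' ℝ (ι (lp.single r n (1 : ℝ)))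
    have h1 := hn g (mem_closedBall_zero_iff.2 hg)
    have h2 := hι (lp.single r n (1 : ℝ))
    rw [lp.norm_single (zero_lt_one.trans_le Fact.out), norm_one] at h2
    rw [hgz] at h1
    have h3 : ‖ι (lp.single r n (1 : ℝ))‖ ≤ 1 / 4 := by simpa using h1
    linarith

theorem exists_isDPL_not_isDPL {p q : ℝ≥0∞} (hp : 1 ≤ p) (hpq : p < q) :
    ∃ (Z : Type) (_ : NormedAddCommGroup Z) (_ : NormedSpace ℝ Z) (_ : CompleteSpace Z)
      (K : Set (StrongDual ℝ Z)), IsDPL p K ∧ ¬ IsDPL q K := by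
  -- A finite intermediate exponent also covers `q = ∞`, since failing at `q'` implies failing at
  -- the larger `q`.
  obtain ⟨q', hpq', hq'⟩ := exists_between hpq
  obtain ⟨Z, i1, i2, i3, K, hK, hK'⟩ := exists_isDPL_not_isDPL_of_ne_top hp hpq' hq'.ne_top
  exact ⟨Z, i1, i2, i3, K, hK, fun h => hK' (h.anti hq'.le)⟩

end Counterexample

end DPLSets

theorem propositionp1
    {X Y : Type*} [NormedAddCommGroup X] [NormedSpace ℝ X] [CompleteSpace X]
    [NormedAddCommGroup Y] [NormedSpace ℝ Y] [CompleteSpace Y]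
    {Ω : Type*} [TopologicalSpace Ω] [CompactSpace Ω] [T2Space Ω]
    [MeasurableSpace Ω] [BorelSpace Ω]
    (p : ℝ≥0∞) (hp : 1 ≤ p) :
    -- (i)
    (∀ K : Set (X →L[ℝ] Y), K ⊆ DPLSets.DPC p X Y → DPLSets.IsRelCompact K →
      DPLSets.IsDPL p K) ∧
    -- (ii)
    (∀ K : Set (X →L[ℝ] Y), DPLSets.IsDPL p K →
      DPLSets.IsDPL p (closedAbsConvexHull ℝ K)) ∧
    -- (iii)
    (∀ K : Set (StrongDual ℝ X), DPLSets.IsRelWeaklyCompact K → DPLSets.IsDPL p K) ∧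
    -- (iv)
    (∀ T : X →L[ℝ] Y, T ∈ DPLSets.DPC p X Y ↔
      DPLSets.IsDPL p (DPLSets.adjoint T '' Metric.closedBall (0 : StrongDual ℝ Y) 1)) ∧
    -- (v)
    (∀ q : ℝ≥0∞, p < q →
      (∀ K : Set (StrongDual ℝ X), DPLSets.IsDPL q K → DPLSets.IsDPL p K) ∧
      (∃ (Z : Type) (_ : NormedAddCommGroup Z) (_ : NormedSpace ℝ Z) (_ : CompleteSpace Z)
        (K : Set (StrongDual ℝ Z)), DPLSets.IsDPL p K ∧ ¬ DPLSets.IsDPL q K)) ∧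
    -- (vi)
    (∀ K : Set (X →L[ℝ] Y), DPLSets.IsDPL p K → ∀ T ∈ K, T ∈ DPLSets.DPC p X Y) ∧
    -- (vii), for subsets of `C(Ω)^*` and for sets of regular signed measures
    (∀ q : ℝ≥0∞, p < q →
      (∀ K : Set (StrongDual ℝ C(Ω, ℝ)), DPLSets.IsDPL p K → DPLSets.IsDPL q K) ∧
      (∀ K : Set (SignedMeasure Ω), K ⊆ DPLSets.regularSignedMeasures Ω →
        DPLSets.IsDPL p (DPLSets.integralFunctional '' K) →
        DPLSets.IsDPL q (DPLSets.integralFunctional '' K))) := by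
  exact ⟨fun K hK hc => DPLSets.isDPL_of_isRelCompact hK hc,
    fun K hK => hK.closedAbsConvexHull,
    fun K hK => DPLSets.isDPL_of_isRelWeaklyCompact hK,
    fun T => DPLSets.mem_DPC_iff_isDPL_adjoint T,
    fun q hpq => ⟨fun K hK => hK.anti hpq.le, DPLSets.exists_isDPL_not_isDPL hp hpq⟩,
    fun K hK T hT => hK.subset_DPC hT,
    fun q _ => ⟨fun K hK => hK.of_continuousMap hp, fun K _ hK => hK.of_continuousMap hp⟩⟩
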